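/- A \emph{game} has a finite set $I$ of players and, for every $i\in I$, finite sets $A^i$ of actions, $B^i$ of observations and $V^i$ of local states; let $A,B,V$ be the sets of profiles (an element of $V$ is a global state). It is given by an initial state $v_0\in V$ and a transition function $\gamma:V\times A\to V\times B$. In round $t\ge 1$ every player $i$ chooses an action $a_t^i$; then $(v_t,b_t)=\gamma(v_{t-1},a_t)$ gives the next global state, and player $i$ privately receives $b_t^i$, from which her own action $a_t^i$ and her own local state $v_t^i$ can be read off; she is otherwise informed of the other players' actions and local states only through $b_t^i$ (imperfect monitoring). A \emph{play} is an infinite sequence $v_0a_1v_1a_2v_2\dots$ arising in this way, and a \emph{history} is a finite prefix $v_0a_1v_1\dots a_tv_t$ of a play. Write $\pi\sim^i\pi'$ if player $i$ receives the same sequence of observations along the histories $\pi,\pi'$. A set $E$ of histories is \emph{common knowledge} among $C\subseteq I$ at a history $\pi$ if $E$ contains every history reachable from $\pi$ by a finite (possibly empty) chain of steps in the relations $\sim^i$, $i\in C$. A \emph{strategy} of player $i$ is a map $s^i:(B^i)^*\to A^i$; it is \emph{finite-state} if it is computed by an automaton with finite memory. The \emph{outcome} $\mathrm{out}(s)$ of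 a strategy profile $s$ is the unique play that follows it. For a play $\pi$, let $D^i(\pi)$ be the set of histories that disagree with $\pi$ and whose first difference from $\pi$ lies only in the action of player $i$. Given a set $W$ of plays, $s$ is a \emph{deviator detection strategy} with respect to $W$ if (i) $\pi=\mathrm{out}(s)\in W$, and (ii) for every player $i$ and every strategy $r^i$ of player $i$ such that $\pi'=\mathrm{out}(s^{-i},r^i)$ differs from $\pi$, the coalition $I\setminus\{i\}$ has common knowledge of $D^i(\pi)$ at some history of $\pi'$. \textbf{Theorem.} The synthesis problem for deviator detection strategies is undecidable for games with imperfect monitoring: there is no algorithm that, given a game (as an explicit finite description) and a finite automaton (a Büchi automaton reading the states and action profiles of a play) specifying a set $W$ of plays, decides whether there is a profile of finite-state strategies that is a deviator detection strategy with respect to $W$. -/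

import Mathlib

namespace DeviatorDetection

/-- A game form with players `I`, action sets `A i`, observation sets `B i` and local state sets
`V i`. A global state is a profile of local states. In every round each player chooses an action;
the transition function then determines the next global state and the observation that each player
receives privately. The action that player `i` has just played and the local state that she has
just reached are part of her observation: they can be read off from it. -/
structure Game {I : Type} (A B V : I → Type) where
  /-- the designated initial global state -/
  init : ∀ i, V i
  /-- the transition function -/
  trans : (∀ i, V i) → (∀ i, A i) → (∀ i, V i) × (∀ i, B i)
  /-- own actions and own local states are included in the observations -/
  own : ∀ i, ∃ read : B i → A i × V i, ∀ v a,
    read ((trans v a).2 i) = (a i, (trans v a).1 i)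

/-- A play, given by its sequence of action profiles (`π t` is the profile played in round `t + 1`).
As the initial state is fixed and the transition function is deterministic, the states and the
observations along the play are determined by the actions. -/
abbrev Play {I : Type} (A : I → Type) : Type := ℕ → ∀ i, A i

/-- A history, given by its sequence of action profiles, in chronological order. -/
abbrev History {I : Type} (A : I → Type) : Type := List (∀ i, A i)

/-- A strategy profile: every player maps each sequence of her observations to an action. -/
abbrev StrategyProfile {I : Type} (A B : I → Type) : Type := ∀ i, List (B i) → A i

/-- The history of length `t` in the play `π`. -/
def Play.history {I : Type} {A : I → Type} (π : Play A) (t : ℕ) : History A :=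
  (List.range t).map π

/-- The event that player `i` has deviated from `π`: the history `τ` disagrees with `π`, and in the
first round in which they disagree they differ only in the action of player `i`. -/
def deviation {I : Type} {A : I → Type} (π : Play A) (i : I) : Set (History A) :=
  {τ | ∃ (t : ℕ) (ht : t < τ.length), τ.take t = π.history t ∧
    τ[t] ≠ π t ∧ ∀ j, j ≠ i → τ[t] j = π t j}

namespace Game

variable {I : Type} {A B V : I → Type}

/-- The global state at the end of a history. -/
def state (G : Game A B V) (h : History A) : ∀ i, V i :=
  h.foldl (fun v a => (G.trans v a).1) G.init

/-- The profiles of observations delivered when the action profiles in the list are played from the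
state `v`. -/
def observationsFrom (G : Game A B V) : (∀ i, V i) → History A → List (∀ i, B i)
  | _, [] => []
  | v, a :: h => (G.trans v a).2 :: G.observationsFrom (G.trans v a).1 h

/-- The sequence of observations received by player `i` along a history. -/
def view (G : Game A B V) (i : I) (h : History A) : List (B i) :=
  (G.observationsFrom G.init h).map (fun b => b i)

/-- Two histories are indistinguishable for player `i`. -/
def Indist (G : Game A B V) (i : I) (h h' : History A) : Prop :=
  G.view i h = G.view i h'

/-- The event `E` is common knowledge among the players in `C` at the history `h`: it occurs at
every history that can be reached from `h` by finitely many steps, each between two histories that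
some player in `C` cannot distinguish. -/
def CommonKnowledge (G : Game A B V) (C : Set I) (E : Set (History A)) (h : History A) : Prop :=
  ∀ h', Relation.ReflTransGen (fun h₁ h₂ => ∃ i ∈ C, G.Indist i h₁ h₂) h h' → h' ∈ E

/-- The play `π` follows the strategy profile `s`. -/
def Follows (G : Game A B V) (s : StrategyProfile A B) (π : Play A) : Prop :=
  ∀ t i, π t i = s i (G.view i (π.history t))

/-- The history of length `t` that follows the strategy profile `s`. -/
def outHistory (G : Game A B V) (s : StrategyProfile A B) : ℕ → History A
  | 0 => []
  | t + 1 => G.outHistory s t ++ [fun i => s i (G.view i (G.outHistory s t))]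

/-- The outcome of the strategy profile `s`: the play that follows it. -/
def out (G : Game A B V) (s : StrategyProfile A B) : Play A :=
  fun t i => s i (G.view i (G.outHistory s t))

/-- The outcome is the unique play that follows the strategy profile. -/
theorem follows_iff_eq_out (G : Game A B V) (s : StrategyProfile A B) (π : Play A) :
    G.Follows s π ↔ π = G.out s := by
  have key : ∀ t, (G.out s).history t = G.outHistory s t := by
    intro t
    induction t with
    | zero => rfl
    | succ t ih =>
      rw [Play.history, List.range_succ, List.map_append, ← Play.history, ih]
      rfl
  constructor
  · intro h
    have hist : ∀ t, π.history t = G.outHistory s t := by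
      intro t
      induction t with
      | zero => rfl
      | succ t ih =>
        rw [Play.history, List.range_succ, List.map_append, ← Play.history, ih]
        have : π t = fun i => s i (G.view i (G.outHistory s t)) := by
          funext i
          rw [h t i, ih]
        simp [outHistory, this]
    funext t i
    rw [h t i, hist t]
    rfl
  · rintro rfl t i
    rw [key t]
    rfl

/-- The strategy profile `s` is a deviator detection strategy with respect to the set `W` of plays:
its outcome lies in `W`, and whenever a unilateral change of strategy of some player `i` leads to a
different play, the other players attain common knowledge, at some history of that play, that `i`
has deviated from the outcome of `s`. -/
def IsDeviatorDetection [DecidableEq I] (G : Game A B V) (W : Set (Play A))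
    (s : StrategyProfile A B) : Prop :=
  G.out s ∈ W ∧
    ∀ (i : I) (r : List (B i) → A i), G.out (Function.update s i r) ≠ G.out s →
      ∃ t, G.CommonKnowledge {j | j ≠ i} (deviation (G.out s) i)
        ((G.out (Function.update s i r)).history t)

end Game

/-- A strategy is finite-state if it is computed by an automaton with finite memory, which updates
its memory with every observation and determines the next action from its current memory state. -/
def IsFiniteState {β α : Type} (s : List β → α) : Prop :=
  ∃ (k : ℕ) (start : Fin k) (update : Fin k → β → Fin k) (output : Fin k → α),
    ∀ w, s w = output (w.foldl update start)

/-- A (nondeterministic) Büchi automaton with states `Q` over the alphabet `S`. -/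
structure BuchiAutomaton (Q S : Type) where
  start : Q
  step : Q → S → Finset Q
  accept : Finset Q

/-- An infinite word is accepted if some run on it visits accepting states infinitely often. -/
def BuchiAutomaton.Accepts {Q S : Type} (M : BuchiAutomaton Q S) (w : ℕ → S) : Prop :=
  ∃ ρ : ℕ → Q, ρ 0 = M.start ∧ (∀ t, ρ (t + 1) ∈ M.step (ρ t) (w t)) ∧
    ∀ t, ∃ t', t ≤ t' ∧ ρ t' ∈ M.accept

/-- An instance of the synthesis problem for deviator detection: a finite game, in which all finite
sets are initial segments of the natural numbers, and a finite automaton that reads the states and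
action profiles of a play. -/
structure Problem where
  /-- number of players -/
  n : ℕ
  /-- numbers of actions, observations and local states of the players -/
  nA : Fin n → ℕ
  nB : Fin n → ℕ
  nV : Fin n → ℕ
  game : Game (fun i => Fin (nA i)) (fun i => Fin (nB i)) (fun i => Fin (nV i))
  /-- number of states of the automaton -/
  nQ : ℕ
  aut : BuchiAutomaton (Fin nQ) ((∀ i, Fin (nV i)) × (∀ i, Fin (nA i)))

/-- The target set of plays specified by the automaton. -/
def Problem.target (P : Problem) : Set (Play fun i => Fin (P.nA i)) :=
  {π | P.aut.Accepts fun t => (P.game.state (π.history t), π t)}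

/-- The instance has a solution: some profile of finite-state strategies is a deviator detection
strategy with respect to the target set. -/
def Problem.Solvable (P : Problem) : Prop :=
  ∃ s : StrategyProfile (fun i => Fin (P.nA i)) (fun i => Fin (P.nB i)),
    (∀ i, IsFiniteState (s i)) ∧ P.game.IsDeviatorDetection P.target s

/-- All profiles with components in `Fin (m i)`, listed in a fixed order. -/
def profiles {n : ℕ} (m : Fin n → ℕ) : List (∀ i, Fin (m i)) :=
  List.ofFn fun k => finPiFinEquiv.symm k

/-- A profile of numbers, written as a list. -/
def profileCode {n : ℕ} {m : Fin n → ℕ} (x : ∀ i, Fin (m i)) : List ℕ :=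
  List.ofFn fun i => (x i : ℕ)

/-- A finite set of numbers, written as an increasing list. -/
def finsetCode {k : ℕ} (F : Finset (Fin k)) : List ℕ :=
  ((List.finRange k).filter (fun q => q ∈ F)).map Fin.val

/-- The data type of inputs for an algorithm: a description of a game and one of an automaton. -/
abbrev ProblemCode : Type :=
  (List (ℕ × ℕ × ℕ) × List ℕ × List ((List ℕ × List ℕ) × (List ℕ × List ℕ))) ×
    (ℕ × ℕ × List ((ℕ × List ℕ × List ℕ) × List ℕ) × List ℕ)

/-- The explicit description of an instance. For the game: for every player the numbers of actions,
observations and local states; the initial state; the table of the transition function, with one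
entry `((v, a), (v', b))` for every state `v` and action profile `a`. For the automaton: the number
of states; the initial state; the table of the transition relation, with one entry
`((q, v, a), successors)` for every state `q` and letter `(v, a)`; the list of accepting states. -/
def Problem.code (P : Problem) : ProblemCode :=
  ((List.ofFn fun i => (P.nA i, P.nB i, P.nV i),
    profileCode P.game.init,
    (profiles P.nV ×ˢ profiles P.nA).map fun x =>
      ((profileCode x.1, profileCode x.2),
        (profileCode (P.game.trans x.1 x.2).1, profileCode (P.game.trans x.1 x.2).2))),
   (P.nQ,
    (P.aut.start : ℕ),
    (List.finRange P.nQ ×ˢ (profiles P.nV ×ˢ profiles P.nA)).map fun x =>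
      (((x.1 : ℕ), profileCode x.2.1, profileCode x.2.2), finsetCode (P.aut.step x.1 x.2)),
    finsetCode P.aut.accept))

theorem profileCode_injective {n : ℕ} {m : Fin n → ℕ} :
    Function.Injective (profileCode : (∀ i, Fin (m i)) → List ℕ) := by
  intro x y h
  have := List.ofFn_injective h
  funext i
  exact Fin.ext (congrFun this i)

theorem mem_profiles {n : ℕ} {m : Fin n → ℕ} (x : ∀ i, Fin (m i)) : x ∈ profiles m := by
  rw [profiles, List.mem_ofFn]
  exact ⟨finPiFinEquiv x, by simp⟩

theorem finsetCode_injective {k : ℕ} : Function.Injective (finsetCode : Finset (Fin k) → _) := by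
  intro F F' h
  unfold finsetCode at h
  have h2 := List.map_injective_iff.2 Fin.val_injective h
  ext q
  have := congrArg (fun l => q ∈ l) h2
  simpa using this

/-- The description determines the instance. -/
theorem Problem.code_injective : Function.Injective Problem.code := by
  rintro ⟨n, nA, nB, nV, ⟨i0, tr, ow⟩, nQ, ⟨st, stp, ac⟩⟩
    ⟨n', nA', nB', nV', ⟨i0', tr', ow'⟩, nQ', ⟨st', stp', ac'⟩⟩ h
  simp only [Problem.code, Prod.mk.injEq] at h
  obtain ⟨⟨h1, h2, h3⟩, h4, h5, h6, h7⟩ := h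
  have hn : n = n' := by simpa using congrArg List.length h1
  subst hn
  have h1' := List.ofFn_injective h1
  have hA : nA = nA' := by funext i; have := congrFun h1' i; simp at this; exact this.1
  have hB : nB = nB' := by funext i; have := congrFun h1' i; simp at this; exact this.2.1
  have hV : nV = nV' := by funext i; have := congrFun h1' i; simp at this; exact this.2.2
  subst hA hB hV h4
  have e1 := profileCode_injective h2
  have e2 : tr = tr' := by
    funext v a
    have := (List.map_inj_left.1 h3) (v, a) (by simp [mem_profiles])
    simp only [Prod.mk.injEq] at this
    exact Prod.ext (profileCode_injective this.2.1) (profileCode_injective this.2.2)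
  have e3 := Fin.ext h5
  have e4 := finsetCode_injective h7
  have e5 : stp = stp' := by
    funext q x
    have := (List.map_inj_left.1 h6) (q, x) (List.mem_product.2 ⟨List.mem_finRange q,
      List.mem_product.2 ⟨mem_profiles x.1, mem_profiles x.2⟩⟩)
    simp only [Prod.mk.injEq] at this
    exact finsetCode_injective this.2
  subst e1 e2 e3 e4 e5
  rfl
end DeviatorDetection

/-!
Undecidability comes from the fact that common knowledge is an infinite iteration: it asks for the
connected component of a history in the union of the indistinguishability relations.
Letter-to-letter transducers make these components simulate computations.

*Computations.* `stackTransducer` performs one step of a stack machine on words of the form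
`pad ⋯ pad (ctl c) (cell s₀) (cell s₁) ⋯ blank ⋯ blank`. It is deterministic and reads letter by
letter, it is stuck exactly at halting configurations, it never turns another letter into a blank,
and every step adds a pad. On words of a fixed length `t` the iteration therefore ends with a word
that still contains a blank if the machine halts and `t` is large enough, and otherwise it reaches a
word without blanks (`eval_stackStep_dom`). Applied to the stack program of Mathlib for a
partial recursive function with undecidable domain, this gives a single transducer `T` for which it
is undecidable whether, for some `t`, every word obtained by iterating `T` on the prefix of length
`t` of `tick ^ n · mark · blank ^ ω` contains a blank (`exists_transducer_not_computable`).

*The game.* There are four players: the deviator `0`, the observers `1` and `2`, and player `3`,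
who writes words. The automaton admits a single play; in it everybody plays `0`, except that player
`3` plays `1` in round `n + 3`. Every deviation from this play becomes public at once, except if
player `0` departs in the very first round. Then the observers are shown the input word for `n`,
because player `3` notices the deviation only when she has played her `1`. They cannot exclude that
player `3` is writing an arbitrary word `w` instead, and here there are two modes: in the first,
both see `w`; in the second, observer `1` sees `w` and observer `2` sees `T w`. So by alternating
between the observers a chain of histories leads from `w` to `T w` and back. Finally, words without
blanks may also stem from histories in which the players `0` and `3` departed together in the first
round; these are not deviations of player `0`. As `T` is deterministic and preserves the absence of
blanks, the chain from the input word reaches such a history if and only if iterating `T` on the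
input word reaches a word without blanks. Hence the deviation of player `0` becomes common
knowledge if and only if some prefix of the input word keeps a blank forever
(`Spec.solvable_problem_iff_blank_mem`).

Only the automaton depends on `n`, so that the instances are easily seen to be computable from `n`
(`Spec.computable_code_problem`).
-/

namespace DeviatorDetection

open StateTransition

/-! ### Letter-to-letter transducers -/

/-- A partial deterministic letter-to-letter transducer over the alphabet `L`, with memory `M`. -/
structure Transducer (M L : Type) where
  start : M
  step : M → L → Option (M × L)

namespace Transducer

variable {M L : Type}

/-- The output word of the transducer, started with memory `m`. It is undefined if the transducer
gets stuck. -/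
def runFrom (T : Transducer M L) : M → List L → Option (List L)
  | _, [] => some []
  | m, l :: w => (T.step m l).bind fun p => (T.runFrom p.1 w).map (p.2 :: ·)

/-- The partial function on words that the transducer computes. -/
def run (T : Transducer M L) (w : List L) : Option (List L) :=
  T.runFrom T.start w

theorem runFrom_cons {T : Transducer M L} {m m' : M} {l l' : L} (h : T.step m l = some (m', l'))
    (w : List L) : T.runFrom m (l :: w) = (T.runFrom m' w).map (l' :: ·) := by
  simp [runFrom, h]

theorem runFrom_cons_eq_some {T : Transducer M L} {m : M} {l : L} {w v : List L} :
    T.runFrom m (l :: w) = some v ↔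
      ∃ m' l' v', T.step m l = some (m', l') ∧ T.runFrom m' w = some v' ∧ v = l' :: v' := by
  simp only [runFrom, Option.bind_eq_some_iff, Option.map_eq_some_iff, Prod.exists]
  constructor
  · rintro ⟨m', l', h, v', h', rfl⟩
    exact ⟨m', l', v', h, h', rfl⟩
  · rintro ⟨m', l', v', h, h', rfl⟩
    exact ⟨m', l', h, v', h', rfl⟩

theorem length_runFrom {T : Transducer M L} {m : M} {w v : List L} (h : T.runFrom m w = some v) :
    v.length = w.length := by
  induction w generalizing m v with
  | nil => simp [runFrom] at h; simp [h]
  | cons l w ih =>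
    obtain ⟨m', l', v', -, h', rfl⟩ := runFrom_cons_eq_some.1 h
    simp [ih h']

theorem runFrom_take {T : Transducer M L} {m : M} {w v : List L} (h : T.runFrom m w = some v)
    (t : ℕ) : T.runFrom m (w.take t) = some (v.take t) := by
  induction w generalizing m v t with
  | nil => simp [runFrom] at h; simp [h, runFrom]
  | cons l w ih =>
    obtain ⟨m', l', v', h1, h', rfl⟩ := runFrom_cons_eq_some.1 h
    cases t with
    | zero => simp [runFrom]
    | succ t => simp [runFrom_cons h1, ih h']

/-- Iterating the transducer is compatible with prefixes, because it works letter by letter. -/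
theorem reaches_take {T : Transducer M L} {w v : List L} (h : Reaches T.run w v) (t : ℕ) :
    Reaches T.run (w.take t) (v.take t) := by
  induction h with
  | refl => exact .refl
  | tail _ h ih => exact ih.tail (runFrom_take h t)

/-- The transducer never replaces another letter by `b`. -/
def Preserves (T : Transducer M L) (b : L) : Prop :=
  ∀ m l m' l', T.step m l = some (m', l') → l ≠ b → l' ≠ b

theorem Preserves.runFrom {T : Transducer M L} {b : L} (hT : T.Preserves b) {m : M} {w v : List L}
    (h : T.runFrom m w = some v) (hw : b ∉ w) : b ∉ v := by
  induction w generalizing m v with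
  | nil => simp [Transducer.runFrom] at h; simp [h]
  | cons l w ih =>
    obtain ⟨m', l', v', h1, h', rfl⟩ := runFrom_cons_eq_some.1 h
    simp only [List.mem_cons, not_or] at hw ⊢
    exact ⟨(hT _ _ _ _ h1 (Ne.symm hw.1)).symm, ih h' hw.2⟩

theorem Preserves.reaches {T : Transducer M L} {b : L} (hT : T.Preserves b) {w v : List L}
    (h : Reaches T.run w v) (hw : b ∉ w) : b ∉ v := by
  induction h with
  | refl => exact hw
  | tail _ h ih => exact hT.runFrom h ih

end Transducer

/-- The prefix of length `t` of the infinite word `tick ^ n · mark · blank ^ ω`. -/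
def inputWord {L : Type} (tick mark blank : L) (n t : ℕ) : List L :=
  (List.range t).map fun j => if j < n then tick else if j = n then mark else blank

/-! ### Stack machines -/

/-- The instructions of a machine with stacks indexed by `K`, stack symbols `Γ` and control states
`C`: each of them operates on at most one stack. -/
inductive Instr (K Γ C : Type)
  | halt
  | push (k : K) (a : Γ) (c : C)
  | pop (k : K) (g : Option Γ → C)
  | peek (k : K) (g : Option Γ → C)
  | jump (c : C)

namespace Instr

variable {K Γ C D : Type}

/-- Renaming of control states. -/
def map (f : C → D) : Instr K Γ C → Instr K Γ D
  | halt => halt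
  | push k a c => push k a (f c)
  | pop k g => pop k (f ∘ g)
  | peek k g => peek k (f ∘ g)
  | jump c => jump (f c)

/-- The control states that an instruction may lead to. -/
def targets : Instr K Γ C → Set C
  | halt => ∅
  | push _ _ c => {c}
  | pop _ g => Set.range g
  | peek _ g => Set.range g
  | jump c => {c}

variable [DecidableEq K]

/-- The effect of an instruction when `top` shows the topmost symbols: the new control state, for
every stack whether it grows (`gt`), shrinks (`lt`) or stays (`eq`), and the symbols pushed. -/
def exec (top : K → Option Γ) : Instr K Γ C → Option (C × (K → Ordering) × (K → Option Γ))
  | halt => none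
  | push k a c => some (c, Function.update (fun _ => .eq) k .gt, fun _ => some a)
  | pop k g => some (g (top k), Function.update (fun _ => .eq) k .lt, fun _ => none)
  | peek k g => some (g (top k), fun _ => .eq, fun _ => none)
  | jump c => some (c, fun _ => .eq, fun _ => none)

theorem exec_push_isSome {top : K → Option Γ} {i : Instr K Γ C} {c : C} {sh : K → Ordering}
    {new : K → Option Γ} (h : i.exec top = some (c, sh, new)) {k : K} (hk : sh k = .gt) :
    (new k).isSome := by
  cases i with
  | halt => simp [exec] at h
  | push k' a c' => simp only [exec, Option.some.injEq, Prod.mk.injEq] at h; simp [← h.2.2]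
  | pop k' g =>
    simp only [exec, Option.some.injEq, Prod.mk.injEq] at h
    rw [← h.2.1] at hk
    by_cases e : k = k' <;> simp [e] at hk
  | peek | jump =>
    simp only [exec, Option.some.injEq, Prod.mk.injEq] at h
    rw [← h.2.1] at hk
    simp at hk

theorem exec_mem_targets {top : K → Option Γ} {i : Instr K Γ C}
    {y : C × (K → Ordering) × (K → Option Γ)} (h : i.exec top = some y) : y.1 ∈ i.targets := by
  cases i <;> simp [exec] at h <;> simp [← h, targets]

theorem exec_map (f : C → D) (i : Instr K Γ C) (top : K → Option Γ) :
    (i.map f).exec top = (i.exec top).map fun y => (f y.1, y.2) := by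
  cases i <;> rfl

end Instr

/-- The change of one stack: `o` tells whether it grows, stays or shrinks. -/
def shiftStack {Γ : Type} (o : Ordering) (a : Option Γ) (s : List Γ) : List Γ :=
  match o with
  | .gt => a.toList ++ s
  | .eq => s
  | .lt => s.tail

section StackMachine

variable {K Γ C : Type}

/-- One step of a stack machine. Configurations consist of a control state and of the stacks. -/
def stackStep [DecidableEq K] (M : C → Instr K Γ C) (x : C × (K → List Γ)) :
    Option (C × (K → List Γ)) :=
  ((M x.1).exec fun k => (x.2 k)[0]?).map fun y =>
    (y.1, fun k => shiftStack (y.2.1 k) (y.2.2 k) (x.2 k))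

/-! ### Transducers that simulate stack machines -/

/-- The letters that describe configurations: the word `pad ⋯ pad (ctl c) (cell s₀) (cell s₁) ⋯`
followed by blanks stands for the control state `c` and the stacks whose symbols at depth `j` are
given by `s j`. -/
inductive Letter (K Γ C : Type)
  | blank
  | pad
  | ctl (c : C)
  | cell (s : K → Option Γ)

/-- The letter for a layer of the stacks, where `none` lies beyond the range in use. -/
def Letter.ofLayer : Option (K → Option Γ) → Letter K Γ C
  | none => .blank
  | some s => .cell s

/-- The inverse of `Letter.ofLayer`. -/
def Letter.layer : Letter K Γ C → Option (Option (K → Option Γ))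
  | .blank => some none
  | .cell s => some (some s)
  | _ => none

/-- The memory of the transducer that simulates one step of a stack machine: before the first layer
the current control state, afterwards the effect on the stacks and the last two layers. -/
inductive Mem (K Γ C : Type)
  | ctl (c : C)
  | body (sh : K → Ordering) (p q : Option (K → Option Γ))

/-- A layer of the new stacks, computed from three consecutive layers of the old stacks. -/
def newLayer (sh : K → Ordering) (p q r : Option (K → Option Γ)) : K → Option Γ := fun k =>
  match sh k with
  | .gt => p.bind (· k)
  | .eq => q.bind (· k)
  | .lt => r.bind (· k)

/-- The transducer that maps the description of a configuration to the description of its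
successor, shifted by one position: in this way each layer is output when the next layer of the
old configuration is known. It is stuck at halting configurations. A word without a control letter
is read as if the control state were `c₀`. -/
def stackTransducer [DecidableEq K] (M : C → Instr K Γ C) (c₀ : C) :
    Transducer (Mem K Γ C) (Letter K Γ C) where
  start := .ctl c₀
  step
    | .ctl c, .pad => some (.ctl c, .pad)
    | .ctl _, .ctl c => some (.ctl c, .pad)
    | .ctl c, l => l.layer.bind fun r =>
        ((M c).exec fun k => r.bind (· k)).map fun y =>
          (.body y.2.1 (some y.2.2) r, .ctl y.1)
    | .body sh p q, l => l.layer.map fun r =>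
        (.body sh q r, .ofLayer (if p = none ∧ r = none then none else some (newLayer sh p q r)))

theorem stackTransducer_preserves [DecidableEq K] (M : C → Instr K Γ C) (c₀ : C) :
    (stackTransducer M c₀).Preserves .blank := by
  rintro (c | ⟨sh, p, q⟩) l m' l' h hl
  · cases l with
    | blank => exact absurd rfl hl
    | pad | ctl => simp [stackTransducer] at h; simp [← h.2]
    | cell s =>
      simp only [stackTransducer, Letter.layer, Option.bind_some, Option.map_eq_some_iff,
        Prod.mk.injEq] at h
      obtain ⟨y, -, -, rfl⟩ := h
      simp
  · cases l with
    | blank => exact absurd rfl hl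
    | pad | ctl => simp [stackTransducer, Letter.layer] at h
    | cell s =>
      simp only [stackTransducer, Letter.layer, Option.map_some, Option.some.injEq,
        Prod.mk.injEq] at h
      simp [← h.2, Letter.ofLayer]

/-- The layer of the stacks `S` at depth `j`, where only the depths below `e` are in use. -/
def layerAt (e : ℕ) (S : K → List Γ) (j : ℕ) : Option (K → Option Γ) :=
  if j < e then some fun k => (S k)[j]? else none

/-- The letters for the layers of `S` at the depths `j, …, j + t - 1`. -/
def layers (C : Type) (e : ℕ) (S : K → List Γ) (j t : ℕ) : List (Letter K Γ C) :=
  (List.range' j t).map fun i => .ofLayer (layerAt e S i)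

theorem layerAt_bind {e : ℕ} {S : K → List Γ} (hS : ∀ k, (S k).length ≤ e) (j : ℕ) (k : K) :
    (layerAt e S j).bind (· k) = (S k)[j]? := by
  unfold layerAt
  split_ifs with h
  · rfl
  · have := hS k
    simp only [Option.bind_none]
    rw [List.getElem?_eq_none (by omega)]

theorem step_body [DecidableEq K] (M : C → Instr K Γ C) (c₀ : C) (sh : K → Ordering)
    (p q r : Option (K → Option Γ)) :
    (stackTransducer M c₀).step (.body sh p q) (.ofLayer r) =
      some (.body sh q r, .ofLayer (if p = none ∧ r = none then none
        else some (newLayer sh p q r))) := by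
  cases r <;> rfl

/-- The transducer computes the new layers from depth `j` on. -/
theorem runFrom_body [DecidableEq K] (M : C → Instr K Γ C) (c₀ : C) {e : ℕ} {S : K → List Γ}
    (hS : ∀ k, (S k).length ≤ e) {sh : K → Ordering} {new : K → Option Γ}
    (hnew : ∀ k, sh k = .gt → (new k).isSome) (j t : ℕ) :
    (stackTransducer M c₀).runFrom
        (.body sh (if j = 0 then some new else layerAt e S (j - 1)) (layerAt e S j))
        (layers C e S (j + 1) t) =
      some (layers C (e + 1) (fun k => shiftStack (sh k) (new k) (S k)) j t) := by
  induction t generalizing j with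
  | zero => rfl
  | succ t ih =>
    have key : (stackTransducer M c₀).step
        (.body sh (if j = 0 then some new else layerAt e S (j - 1)) (layerAt e S j))
        (.ofLayer (layerAt e S (j + 1))) = some (.body sh (layerAt e S j) (layerAt e S (j + 1)),
          .ofLayer (layerAt (e + 1) (fun k => shiftStack (sh k) (new k) (S k)) j)) := by
      have h1 : ((if j = 0 then some new else layerAt e S (j - 1)) = none ∧
          layerAt e S (j + 1) = none) ↔ ¬ j < e + 1 := by
        unfold layerAt
        split_ifs <;> simp <;> omega
      rw [step_body]
      congr 3
      rw [layerAt.eq_def (e + 1)]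
      by_cases hj : j < e + 1
      · rw [if_pos hj, if_neg (fun h => h1.1 h hj)]
        congr 1
        funext k
        unfold newLayer shiftStack
        cases hk : sh k with
        | lt => simp [layerAt_bind hS]
        | eq => simp [layerAt_bind hS]
        | gt =>
          obtain ⟨a, ha⟩ := Option.isSome_iff_exists.1 (hnew k hk)
          cases j with
          | zero => simp [ha]
          | succ j => simp [ha, layerAt_bind hS]
      · rw [if_neg hj, if_pos (h1.2 hj)]
    have := ih (j + 1)
    simp only [Nat.add_eq_zero_iff, one_ne_zero, and_false, if_false, Nat.add_sub_cancel] at this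
    unfold layers at this ⊢
    rw [List.range'_succ, List.range'_succ, List.map_cons, List.map_cons,
      Transducer.runFrom_cons key, this]
    rfl

/-- From the control state on, the transducer computes the successor configuration. One layer of
the input is lost to the delay, and one more depth comes into use. -/
theorem runFrom_ctl [DecidableEq K] (M : C → Instr K Γ C) (c₀ : C) {e : ℕ} {x : C × (K → List Γ)}
    (hS : ∀ k, (x.2 k).length ≤ e) (t : ℕ) :
    (stackTransducer M c₀).runFrom (.ctl x.1) (layers C e x.2 0 (t + 1)) =
      (stackStep M x).map fun y => .ctl y.1 :: layers C (e + 1) y.2 0 t := by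
  have hstep : (stackTransducer M c₀).step (.ctl x.1) (.ofLayer (layerAt e x.2 0)) =
      ((M x.1).exec fun k => (x.2 k)[0]?).map fun y =>
          (.body y.2.1 (some y.2.2) (layerAt e x.2 0), .ctl y.1) := by
    have : (fun k => (x.2 k)[0]?) = fun k => (layerAt e x.2 0).bind (· k) := by
      funext k
      exact (layerAt_bind hS 0 k).symm
    rw [this]
    cases hl : layerAt e x.2 0 <;> rfl
  cases hy : (M x.1).exec fun k => (x.2 k)[0]? with
  | none =>
    rw [hy] at hstep
    simp [layers, List.range'_succ, Transducer.runFrom, hstep, stackStep, hy]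
  | some y =>
    obtain ⟨c, sh, new⟩ := y
    rw [hy] at hstep
    have := runFrom_body M c₀ hS (fun k => Instr.exec_push_isSome hy (k := k)) 0 t
    rw [if_pos rfl] at this
    unfold layers at this ⊢
    rw [List.range'_succ, List.map_cons, Transducer.runFrom_cons hstep, this]
    simp [stackStep, hy]

/-- The beginning of the word that describes a configuration after `i` steps. -/
def header (K Γ : Type) {C : Type} (i : ℕ) (c : C) : List (Letter K Γ C) :=
  match i with
  | 0 => []
  | i + 1 => List.replicate i .pad ++ [.ctl c]

theorem run_header [DecidableEq K] (M : C → Instr K Γ C) (c₀ : C) {i : ℕ} {c : C}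
    (hi : i = 0 → c = c₀)
    (w : List (Letter K Γ C)) :
    (stackTransducer M c₀).run (header K Γ i c ++ w) =
      ((stackTransducer M c₀).runFrom (.ctl c) w).map (List.replicate i .pad ++ ·) := by
  unfold Transducer.run
  change (stackTransducer M c₀).runFrom (.ctl c₀) _ = _
  cases i with
  | zero => simp [header, hi]
  | succ i =>
    clear hi
    simp only [header]
    induction i with
    | zero =>
      simp only [List.replicate, List.nil_append, List.cons_append]
      rw [Transducer.runFrom_cons (m' := .ctl c) (l' := .pad) rfl]
    | succ i ih =>
      rw [List.replicate_succ, List.cons_append, List.cons_append,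
        Transducer.runFrom_cons (m' := .ctl c₀) (l' := .pad) rfl, ih, Option.map_map]
      rfl

/-- After `i` steps the transducer has turned the word for `x₀` into the word for `x`. -/
def Simulates [DecidableEq K] (M : C → Instr K Γ C) (x₀ : C × (K → List Γ))
    (e i : ℕ) (x : C × (K → List Γ)) :
    Prop :=
  (i = 0 → x.1 = x₀.1) ∧ (∀ k, (x.2 k).length ≤ e + i) ∧ ∀ r,
    Reaches (stackTransducer M x₀.1).run (layers C e x₀.2 0 (i + r))
      (header K Γ i x.1 ++ layers C (e + i) x.2 0 r)

theorem Simulates.run [DecidableEq K] {M : C → Instr K Γ C} {x₀ x : C × (K → List Γ)} {e i : ℕ}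
    (h : Simulates M x₀ e i x) (r : ℕ) :
    (stackTransducer M x₀.1).run (header K Γ i x.1 ++ layers C (e + i) x.2 0 (r + 1)) =
      (stackStep M x).map fun y => header K Γ (i + 1) y.1 ++ layers C (e + i + 1) y.2 0 r := by
  rw [run_header M x₀.1 h.1, runFrom_ctl M x₀.1 h.2.1, Option.map_map]
  congr 1
  funext y
  simp [header]

theorem length_shiftStack (o : Ordering) (a : Option Γ) (s : List Γ) :
    (shiftStack o a s).length ≤ s.length + 1 := by
  cases o <;> cases a <;> simp [shiftStack] <;> omega

theorem Simulates.step [DecidableEq K] {M : C → Instr K Γ C} {x₀ x y : C × (K → List Γ)} {e i : ℕ}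
    (h : Simulates M x₀ e i x) (hy : stackStep M x = some y) : Simulates M x₀ e (i + 1) y := by
  refine ⟨by simp, fun k => ?_, fun r => ?_⟩
  · simp only [stackStep, Option.map_eq_some_iff] at hy
    obtain ⟨z, -, rfl⟩ := hy
    have := length_shiftStack (z.2.1 k) (z.2.2 k) (x.2 k)
    have := h.2.1 k
    dsimp only
    omega
  · have h1 := h.2.2 (r + 1)
    rw [show i + 1 + r = i + (r + 1) by omega]
    refine h1.tail ?_
    rw [h.run r, hy]
    rfl

theorem mem_layers_blank (e : ℕ) (S : K → List Γ) :
    (.blank : Letter K Γ C) ∈ layers C e S 0 (e + 1) := by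
  simp only [layers, List.mem_map, List.mem_range'_1]
  exact ⟨e, by omega, by simp [layerAt, Letter.ofLayer]⟩

/-- The machine halts if and only if, for some length, the iterates of the transducer on the word
for the initial configuration never lose their last blank. -/
theorem eval_stackStep_dom [DecidableEq K] (M : C → Instr K Γ C) (x₀ : C × (K → List Γ)) {e : ℕ}
    (he : ∀ k, (x₀.2 k).length ≤ e) :
    (eval (stackStep M) x₀).Dom ↔ ∃ t, ∀ w,
      Reaches (stackTransducer M x₀.1).run (layers C e x₀.2 0 t) w → .blank ∈ w := by
  have h0 : Simulates M x₀ e 0 x₀ := ⟨fun _ => rfl, he, fun r => by simpa [header] using .refl⟩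
  have hpres := stackTransducer_preserves M x₀.1
  constructor
  · intro h
    obtain ⟨x, hx⟩ := Part.dom_iff_mem.1 h
    obtain ⟨hr, hn⟩ := mem_eval.1 hx
    obtain ⟨i, hi⟩ : ∃ i, Simulates M x₀ e i x := by
      clear hn hx
      induction hr with
      | refl => exact ⟨0, h0⟩
      | tail _ hs ih =>
        obtain ⟨i, hi⟩ := ih
        exact ⟨i + 1, hi.step hs⟩
    -- This length leaves room for all layers in use when the machine halts, and for a blank.
    refine ⟨i + (e + i + 1), fun w hw => ?_⟩
    have h1 := hi.2.2 (e + i + 1)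
    have h2 := hi.run (e + i)
    rw [hn, Option.map_none] at h2
    have hb : Letter.blank ∈ header K Γ i x.1 ++ layers C (e + i) x.2 0 (e + i + 1) :=
      List.mem_append_right _ (mem_layers_blank _ _)
    rcases reaches_total hw h1 with h3 | h3
    · by_contra hw'
      exact hpres.reaches h3 hw' hb
    · rcases Relation.ReflTransGen.cases_head h3 with rfl | ⟨v, hv, -⟩
      · exact hb
      · rw [h2] at hv
        cases hv
  · rintro ⟨t, ht⟩
    by_contra h
    have hex : ∀ i, ∃ x, Reaches (stackStep M) x₀ x ∧ Simulates M x₀ e i x := by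
      intro i
      induction i with
      | zero => exact ⟨x₀, .refl, h0⟩
      | succ i ih =>
        obtain ⟨x, hr, hx⟩ := ih
        cases hs : stackStep M x with
        | none => exact absurd (Part.dom_iff_mem.2 ⟨x, mem_eval.2 ⟨hr, hs⟩⟩) h
        | some y => exact ⟨y, hr.tail hs, hx.step hs⟩
    -- After `t + 1` steps the first `t` letters are pads.
    obtain ⟨x, -, hx⟩ := hex (t + 1)
    have h1 := Transducer.reaches_take (hx.2.2 0) t
    have e1 : (layers C e x₀.2 0 (t + 1 + 0)).take t = layers C e x₀.2 0 t := by
      rw [layers, layers, ← List.map_take, ← List.range_eq_range', ← List.range_eq_range',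
        List.take_range]
      simp
    have e2 : (header K Γ (t + 1) x.1 ++ layers C (e + (t + 1)) x.2 0 0).take t =
        List.replicate t .pad := by
      simp [header, layers]
    rw [e1, e2] at h1
    have := ht _ h1
    simp [List.mem_replicate] at this

end StackMachine

/-! ### Stack programs for partial recursive functions -/

section StackMachine

variable {K Γ C : Type}

/-- The restriction of a stack machine to a set of control states that it never leaves. -/
noncomputable def restrict (M : C → Instr K Γ C) (F : Set C) (c : F) : Instr K Γ F :=
  open scoped Classical in (M c).map fun d => if h : d ∈ F then ⟨d, h⟩ else c

/-- Restricting the control states does not affect halting. -/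
theorem eval_restrict_dom [DecidableEq K] {M : C → Instr K Γ C} {F : Set C}
    (hF : ∀ c ∈ F, (M c).targets ⊆ F) (c : F) (S : K → List Γ) :
    (eval (stackStep (restrict M F)) (c, S)).Dom ↔ (eval (stackStep M) (c.1, S)).Dom := by
  have H : Respects (stackStep (restrict M F)) (stackStep M)
      fun a b => b = (a.1.1, a.2) := by
    rintro ⟨d, S⟩ _ rfl
    cases hy : (M d.1).exec fun k => (S k)[0]? with
    | none =>
      have h1 : stackStep (restrict M F) (d, S) = none := by
        simp [stackStep, restrict, Instr.exec_map, hy]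
      rw [h1]
      simp [stackStep, hy]
    | some y =>
      have hmem : y.1 ∈ F := hF d.1 d.2 (Instr.exec_mem_targets hy)
      have h1 : stackStep (restrict M F) (d, S) =
          some (⟨y.1, hmem⟩, fun k => shiftStack (y.2.1 k) (y.2.2 k) (S k)) := by
        simp [stackStep, restrict, Instr.exec_map, hy, hmem]
      rw [h1]
      refine ⟨_, rfl, .single ?_⟩
      simp [stackStep, hy]
  exact (tr_eval_dom H rfl).symm

open Turing

variable {Λ σ : Type}

/-- The single instructions of a `TM2` program. The control state consists of the statement that is
still to be executed and of the value of the local variable. -/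
def stmtInstr (M : Λ → TM2.Stmt (fun _ : K => Γ) Λ σ) :
    TM2.Stmt (fun _ : K => Γ) Λ σ × σ → Instr K Γ (TM2.Stmt (fun _ : K => Γ) Λ σ × σ)
  | (.push k f q, v) => .push k (f v) (q, v)
  | (.peek k f q, v) => .peek k fun a => (q, f v a)
  | (.pop k f q, v) => .pop k fun a => (q, f v a)
  | (.load a q, v) => .jump (q, a v)
  | (.branch f q₁ q₂, v) => .jump (cond (f v) q₁ q₂, v)
  | (.goto f, v) => .jump (M (f v), v)
  | (.halt, _) => .halt

/-- The correspondence between the configurations of a `TM2` program and those of the machine that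
executes its single instructions. -/
def StmtRel (c : TM2.Cfg (fun _ : K => Γ) Λ σ)
    (x : (TM2.Stmt (fun _ : K => Γ) Λ σ × σ) × (K → List Γ)) : Prop :=
  x.1.2 = c.var ∧ x.2 = c.stk ∧
    match c.l with
    | none => x.1.1 = .halt
    | some l => ∃ f, x.1.1 = .goto f ∧ f c.var = l

/-- Executing a statement as a whole amounts to executing its instructions one by one. -/
theorem exists_reaches_stmtRel [DecidableEq K] (M : Λ → TM2.Stmt (fun _ : K => Γ) Λ σ)
    (q : TM2.Stmt (fun _ : K => Γ) Λ σ) (v : σ) (S : K → List Γ) :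
    ∃ x, StmtRel (TM2.stepAux q v S) x ∧ Reaches (stackStep (stmtInstr M)) ((q, v), S) x := by
  induction q generalizing v S with
  | push k f q ih =>
    obtain ⟨x, hx, hr⟩ := ih v (Function.update S k (f v :: S k))
    refine ⟨x, hx, .head ?_ hr⟩
    simp only [stackStep, stmtInstr, Instr.exec, Option.map_some, Option.mem_def,
      Option.some.injEq, Prod.mk.injEq, true_and]
    funext k'
    by_cases h : k' = k
    · subst h; simp [shiftStack]
    · simp [h, shiftStack]
  | peek k f q ih =>
    obtain ⟨x, hx, hr⟩ := ih (f v (S k).head?) S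
    refine ⟨x, hx, .head ?_ hr⟩
    simp [stackStep, stmtInstr, Instr.exec, shiftStack, List.head?_eq_getElem?]
  | pop k f q ih =>
    obtain ⟨x, hx, hr⟩ := ih (f v (S k).head?) (Function.update S k (S k).tail)
    refine ⟨x, hx, .head ?_ hr⟩
    simp only [stackStep, stmtInstr, Instr.exec, Option.map_some, Option.mem_def,
      Option.some.injEq, Prod.mk.injEq, List.head?_eq_getElem?, true_and]
    funext k'
    by_cases h : k' = k
    · subst h; simp [shiftStack]
    · simp [h, shiftStack]
  | load a q ih =>
    obtain ⟨x, hx, hr⟩ := ih (a v) S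
    exact ⟨x, hx, .head rfl hr⟩
  | branch f q₁ q₂ ih₁ ih₂ =>
    cases h : f v with
    | true =>
      obtain ⟨x, hx, hr⟩ := ih₁ v S
      refine ⟨x, by simpa [h] using hx, .head ?_ hr⟩
      simp [stackStep, stmtInstr, Instr.exec, shiftStack, h]
    | false =>
      obtain ⟨x, hx, hr⟩ := ih₂ v S
      refine ⟨x, by simpa [h] using hx, .head ?_ hr⟩
      simp [stackStep, stmtInstr, Instr.exec, shiftStack, h]
  | goto f => exact ⟨((.goto f, v), S), ⟨rfl, rfl, f, rfl, rfl⟩, .refl⟩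
  | halt => exact ⟨((.halt, v), S), ⟨rfl, rfl, rfl⟩, .refl⟩

theorem eval_stmtInstr_dom [DecidableEq K] (M : Λ → TM2.Stmt (fun _ : K => Γ) Λ σ) (l : Λ) (v : σ)
    (S : K → List Γ) :
    (eval (stackStep (stmtInstr M)) ((M l, v), S)).Dom ↔
      (eval (TM2.step M) ⟨some l, v, S⟩).Dom := by
  have H : Respects (TM2.step M) (stackStep (stmtInstr M)) StmtRel := by
    rintro ⟨_ | l, v, S⟩ ⟨⟨q, v'⟩, S'⟩ ⟨h1, h2, h3⟩
    · dsimp only at h1 h2 h3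
      subst h1 h2 h3
      rfl
    · dsimp only at h1 h2 h3
      obtain ⟨f, rfl, rfl⟩ := h3
      subst h1 h2
      obtain ⟨x, hx, hr⟩ := exists_reaches_stmtRel M (M (f v')) v' S'
      exact ⟨x, hx, .head' rfl hr⟩
  have hr : Reaches (stackStep (stmtInstr M)) ((.goto fun _ => l, v), S) ((M l, v), S) :=
    .single rfl
  rw [← reaches_eval hr]
  exact tr_eval_dom H ⟨rfl, rfl, _, rfl, rfl⟩

/-- The statements that occur in the support of a `TM2` program are closed under execution. -/
theorem targets_stmtInstr [Inhabited Λ] {M : Λ → TM2.Stmt (fun _ : K => Γ) Λ σ} {S : Finset Λ}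
    (hS : TM2.Supports M S) :
    ∀ x ∈ {x : TM2.Stmt (fun _ : K => Γ) Λ σ × σ | some x.1 ∈ TM2.stmts M S},
      (stmtInstr M x).targets ⊆ {x | some x.1 ∈ TM2.stmts M S} := by
  classical
  rintro ⟨q, v⟩ hq y hy
  have hsub : y.1 ∈ TM2.stmts₁ q → some y.1 ∈ TM2.stmts M S := fun h => TM2.stmts_trans h hq
  cases q with
  | push k f q =>
    rw [show y = (q, v) from hy] at hsub ⊢
    exact hsub (by simp [TM2.stmts₁, TM2.stmts₁_self])
  | peek k f q | pop k f q =>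
    obtain ⟨a, rfl⟩ := hy
    exact hsub (by simp [TM2.stmts₁, TM2.stmts₁_self])
  | load a q =>
    rw [show y = (q, a v) from hy] at hsub ⊢
    exact hsub (by simp [TM2.stmts₁, TM2.stmts₁_self])
  | branch f q₁ q₂ =>
    rw [show y = (cond (f v) q₁ q₂, v) from hy] at hsub ⊢
    refine hsub ?_
    cases f v <;> simp [TM2.stmts₁, TM2.stmts₁_self]
  | goto f =>
    rw [show y = (M (f v), v) from hy]
    have h := TM2.stmts_supportsStmt hS hq
    simp only [TM2.stmts, Set.mem_ofPred_eq, Finset.some_mem_insertNone, Finset.mem_biUnion]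
    exact ⟨f v, h v, TM2.stmts₁_self⟩
  | halt => exact hy.elim

/-! ### Finiteness of the alphabets -/

theorem finite_letter [Finite K] [Finite Γ] [Finite C] : Finite (Letter K Γ C) := by
  let f : Letter K Γ C → Option (Option (C ⊕ (K → Option Γ)))
    | .blank => none
    | .pad => some none
    | .ctl c => some (some (.inl c))
    | .cell s => some (some (.inr s))
  refine Finite.of_injective f ?_
  rintro (_ | _ | c | s) (_ | _ | c' | s') h <;> simp_all [f]

theorem finite_mem [Finite K] [Finite Γ] [Finite C] : Finite (Mem K Γ C) := by
  have : Finite Ordering := Finite.of_injective (fun o : Ordering => (o.isLT, o.isGT)) (by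
    intro a b; cases a <;> cases b <;> simp)
  let f : Mem K Γ C → C ⊕ ((K → Ordering) × Option (K → Option Γ) × Option (K → Option Γ))
    | .ctl c => .inl c
    | .body sh p q => .inr (sh, p, q)
  refine Finite.of_injective f ?_
  rintro (c | ⟨sh, p, q⟩) (c' | ⟨sh', p', q'⟩) h <;> simp_all [f]

end StackMachine

/-! ### An undecidable problem for an iterated transducer -/

section Halting

open Turing Turing.PartrecToTM2

/-- The numbers `2 ^ n - 1` have unary binary expansions, so that the initial stack is described by
an input word. -/
theorem trNat_two_pow_sub_one (n : ℕ) : trNat (2 ^ n - 1) = List.replicate n Γ'.bit1 := by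
  induction n with
  | zero => simp
  | succ n ih =>
    have h : ((2 ^ (n + 1) - 1 : ℕ) : Num) = Num.bit1 ((2 ^ n - 1 : ℕ) : Num) := by
      have : 2 ^ (n + 1) - 1 = 2 * (2 ^ n - 1) + 1 := by
        have := Nat.one_le_two_pow (n := n)
        rw [pow_succ]; omega
      rw [this, ← Num.bit1_of_bit1]
      generalize 2 ^ n - 1 = m
      push_cast
      ring
    rw [trNat, h, List.replicate_succ, ← ih, trNat]
    cases ((2 ^ n - 1 : ℕ) : Num) <;> rfl

theorem primrec_two_pow : Primrec fun n : ℕ => 2 ^ n := by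
  refine (Primrec.nat_rec₁ (f := fun _ y => 2 * y) 1
    (Primrec.nat_double.comp Primrec.snd)).of_eq fun n => ?_
  induction n with
  | zero => rfl
  | succ n ih => simp only [pow_succ, ← ih]; ring

/-- Halting is undecidable even for a single partial recursive function, applied to the numbers
`2 ^ n - 1`. -/
theorem exists_partrec_halting_not_computable :
    ∃ f : ℕ →. ℕ, Partrec f ∧ ¬ ComputablePred fun n => (f (2 ^ n - 1)).Dom := by
  let lg : ℕ → ℕ := fun m => Nat.findGreatest (fun k => 2 ^ k ≤ m + 1) m
  have hlg : Primrec lg := by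
    refine Primrec.nat_findGreatest Primrec.id ?_
    exact Primrec.nat_le.comp (primrec_two_pow.comp Primrec.snd) (Primrec.succ.comp Primrec.fst)
  have hlg' : ∀ n, lg (2 ^ n - 1) = n := by
    intro n
    have h1 : 2 ^ n - 1 + 1 = 2 ^ n := Nat.sub_add_cancel Nat.one_le_two_pow
    have h2 : n < 2 ^ n := Nat.lt_two_pow_self
    refine (Nat.findGreatest_eq_iff).2 ⟨by omega, fun _ => h1.ge, fun k hk _ h => ?_⟩
    rw [h1] at h
    exact absurd ((Nat.pow_le_pow_iff_right (by norm_num)).1 h) (by omega)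
  refine ⟨fun m => (Denumerable.ofNat Nat.Partrec.Code (lg m)).eval 0, ?_, fun h => ?_⟩
  · exact Nat.Partrec.Code.eval_part.comp ((Computable.ofNat _).comp hlg.to_comp)
      (Computable.const 0)
  · simp only [hlg'] at h
    refine ComputablePred.halting_problem 0 ?_
    obtain ⟨hd, hc⟩ := h
    refine ⟨fun c => decidable_of_iff
      ((Denumerable.ofNat Nat.Partrec.Code (Encodable.encode c)).eval 0).Dom (by simp), ?_⟩
    refine (hc.comp Computable.encode).of_eq fun c => ?_
    simp

/-- Iterated transductions are undecidable: for some fixed transducer it is undecidable, given `n`,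
whether some prefix of `tick ^ n · mark · blank ^ ω` keeps a blank in all its iterated images. -/
theorem exists_transducer_not_computable :
    ∃ (M L : Type) (_ : Finite M) (_ : Finite L) (T : Transducer M L) (tick mark blank : L),
      T.Preserves blank ∧ tick ≠ blank ∧
      ¬ ComputablePred fun n => ∃ t, ∀ w,
        Reaches T.run (inputWord tick mark blank n t) w → blank ∈ w := by
  obtain ⟨f, hf, hcomp⟩ := exists_partrec_halting_not_computable
  obtain ⟨c, hc⟩ := ToPartrec.Code.exists_code (Nat.Partrec'.part_iff₁.2 hf)
  let _ : Inhabited Λ' := ⟨trNormal c Cont'.halt⟩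
  have hsupp : TM2.Supports tr (codeSupp c Cont'.halt) := tr_supports c Cont'.halt
  set l₀ : Λ' := trNormal c Cont'.halt
  let F : Set (TM2.Stmt (fun _ : K' => Γ') Λ' (Option Γ') × Option Γ') :=
    {x | some x.1 ∈ TM2.stmts tr (codeSupp c Cont'.halt)}
  have hF : Finite F := by
    have h1 : (some ⁻¹' (TM2.stmts tr (codeSupp c Cont'.halt) :
        Set (Option (TM2.Stmt (fun _ : K' => Γ') Λ' (Option Γ'))))).Finite :=
      Set.Finite.preimage (Option.some_injective _).injOn (Finset.finite_toSet _)
    exact ((h1.prod (Set.finite_univ (α := Option Γ'))).subset fun x hx => ⟨hx, trivial⟩).to_subtype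
  have hl₀ : ((tr l₀, none) : TM2.Stmt (fun _ : K' => Γ') Λ' (Option Γ') × Option Γ') ∈ F := by
    simp only [F, TM2.stmts, Set.mem_ofPred_eq, Finset.some_mem_insertNone, Finset.mem_biUnion]
    exact ⟨l₀, hsupp.1, TM2.stmts₁_self⟩
  have hK : Finite K' := Finite.of_injective (fun k : K' => (decide (k = .main), decide (k = .rev),
    decide (k = .aux))) (by intro a b; cases a <;> cases b <;> simp)
  let cellOf : Γ' → Letter K' Γ' F := fun a =>
    .cell fun k => match k with
      | .main => some a
      | _ => none
  refine ⟨_, _, finite_mem, finite_letter, stackTransducer (restrict (stmtInstr tr) F) ⟨_, hl₀⟩,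
    cellOf .bit1, cellOf .cons, .blank, stackTransducer_preserves _ _, by simp [cellOf], ?_⟩
  intro h
  refine hcomp (h.of_eq fun n => ?_)
  set S : K' → List Γ' := K'.elim (trList [2 ^ n - 1]) [] [] [] with hS
  have hmain : S .main = List.replicate n .bit1 ++ [.cons] := by
    simp [hS, trList, trNat_two_pow_sub_one]
  have hlen : ∀ k, (S k).length ≤ n + 1 := by
    intro k
    cases k with
    | main => simp [hmain]
    | rev | aux | stack => simp [hS]
  have hword : ∀ t, inputWord (cellOf .bit1) (cellOf .cons) .blank n t =
      layers F (n + 1) S 0 t := by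
    intro t
    unfold inputWord layers
    rw [List.range_eq_range']
    refine List.map_congr_left fun j _ => ?_
    unfold layerAt
    rcases lt_trichotomy j n with hj | rfl | hj
    · rw [if_pos hj, if_pos (by omega)]
      simp only [cellOf, Letter.ofLayer, Letter.cell.injEq]
      funext k
      cases k with
      | main => simp [hmain, List.getElem?_append, hj]
      | rev | aux | stack => simp [hS]
    · rw [if_neg (lt_irrefl _), if_pos rfl, if_pos (by omega)]
      simp only [cellOf, Letter.ofLayer, Letter.cell.injEq]
      funext k
      cases k with
      | main => simp [hmain]
      | rev | aux | stack => simp [hS]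
    · rw [if_neg (by omega), if_neg (by omega), if_neg (by omega)]
      rfl
  simp only [hword]
  rw [← eval_stackStep_dom (restrict (stmtInstr tr) F) (⟨_, hl₀⟩, S) hlen,
    eval_restrict_dom (targets_stmtInstr hsupp)]
  have h1 := tr_eval c [2 ^ n - 1]
  have h2 := hc ⟨[2 ^ n - 1], rfl⟩
  have h3 : (eval (TM2.step tr) (init c [2 ^ n - 1])).Dom ↔ (f (2 ^ n - 1)).Dom := by
    rw [h1]
    simp only at h2
    rw [h2]
    rfl
  exact (eval_stmtInstr_dom _ _ _ _).trans h3

end Halting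

/-! ### The rules of the game -/

/-- The positions of the game, where `M` is the memory of the transducer. -/
inductive World (M : Type)
  /-- the initial position -/
  | init
  /-- nobody has departed from the action `0` -/
  | quiet
  /-- everybody sees everything -/
  | revealed
  /-- player `0` has departed in the first round, and player `3` is about to choose what happens -/
  | fork
  /-- the observers see an input word, and player `3` does not know it -/
  | input
  /-- the observers see the blanks after an input word -/
  | ended
  /-- both observers see the word that player `3` writes -/
  | copy
  /-- observer `1` sees the word that player `3` writes, and observer `2` sees its image -/
  | convert (m : M)
  /-- the players `0` and `3` have departed together in the first round -/
  | decoyFork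
  /-- both observers see the word that player `3` writes, as long as it has no blank -/
  | decoy
  /-- the observers see an error -/
  | failed

/-- What a player can be told who does not see everything. Player `3` receives `silent` as long as
she cannot tell whether player `0` has departed in the first round, and `told` afterwards. -/
inductive Signal (L : Type)
  | silent
  | told
  | letter (l : L)
  | fail

/-- A profile of actions of the four players. -/
abbrev Profile (k : ℕ) : Type := Fin 4 → Fin (k + 3)

/-- The observations: either the new position and the full profile of actions, or a signal and the
own action. -/
abbrev Obs (M L : Type) (k : ℕ) : Type := (World M × Profile k) ⊕ (Signal L × Fin (k + 3))

/-- The action profile in which only player `0` departs from the action `0`. -/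
def alone {k : ℕ} : Profile k := ![1, 0, 0, 0]

/-- The action profile in which the players `0` and `3` depart from the action `0`. -/
def joint {k : ℕ} : Profile k := ![1, 0, 0, 1]

/-- The data from which the game is built: a transducer, the three letters of the input words, and
`k + 3` actions for every player, each of which stands for a letter. -/
structure Spec (M L : Type) where
  T : Transducer M L
  tick : L
  mark : L
  blank : L
  k : ℕ
  dec : Fin (k + 3) → L
  enc : L → Fin (k + 3)
  dec_enc : ∀ l, dec (enc l) = l

namespace Spec

variable {M L : Type} (D : Spec M L)

open scoped Classical in
/-- The next position and the signals that the players receive, where `none` means that the player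
sees everything. -/
noncomputable def react (w : World M) (a : Profile D.k) :
    World M × (Fin 4 → Option (Signal L)) :=
  match w with
  | .init =>
    if a = 0 then (.quiet, ![none, none, none, some .silent])
    else if a = alone then (.fork, ![none, some .silent, some .silent, some .silent])
    else if a = joint then (.decoyFork, ![none, some .silent, some .silent, some .told])
    else (.revealed, fun _ => none)
  | .quiet =>
    if a = 0 then (.quiet, ![none, none, none, some .silent]) else (.revealed, fun _ => none)
  | .revealed => (.revealed, fun _ => none)
  | .fork =>
    if a 3 = 0 then (.input, ![none, some .silent, some .silent, some .silent])
    else if a 3 = 1 then (.convert D.T.start, ![none, some .silent, some .silent, some .told])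
    else (.copy, ![none, some .silent, some .silent, some .told])
  | .input =>
    if a 3 = 0 then
      (.input, ![none, some (.letter D.tick), some (.letter D.tick), some .silent])
    else (.ended, ![none, some (.letter D.mark), some (.letter D.mark), some .told])
  | .ended => (.ended, ![none, some (.letter D.blank), some (.letter D.blank), some .told])
  | .copy =>
    (.copy, ![none, some (.letter (D.dec (a 3))), some (.letter (D.dec (a 3))), some .told])
  | .convert m =>
    match D.T.step m (D.dec (a 3)) with
    | some (m', l) =>
      (.convert m', ![none, some (.letter (D.dec (a 3))), some (.letter l), some .told])
    | none => (.failed, ![none, some .fail, some .fail, some .told])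
  | .decoyFork => (.decoy, ![none, some .silent, some .silent, some .told])
  | .decoy =>
    if D.dec (a 3) = D.blank then (.failed, ![none, some .fail, some .fail, some .told])
    else (.decoy, ![none, some (.letter (D.dec (a 3))), some (.letter (D.dec (a 3))), some .told])
  | .failed => (.failed, ![none, some .fail, some .fail, some .told])

/-- The observation of player `i` when the profile `a` is played at the position `w`. -/
noncomputable def obs (w : World M) (a : Profile D.k) (i : Fin 4) : Obs M L D.k :=
  match (D.react w a).2 i with
  | none => .inl ((D.react w a).1, a)
  | some o => .inr (o, a i)

/-- The observations of player `i` when the profiles in a list are played from the position `w`. -/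
noncomputable def seen (i : Fin 4) : World M → List (Profile D.k) → List (Obs M L D.k)
  | _, [] => []
  | w, a :: h => D.obs w a i :: seen i (D.react w a).1 h

@[simp] theorem seen_nil (i : Fin 4) (w : World M) : D.seen i w [] = [] := rfl

@[simp] theorem seen_cons (i : Fin 4) (w : World M) (a : Profile D.k) (h : List (Profile D.k)) :
    D.seen i w (a :: h) = D.obs w a i :: D.seen i (D.react w a).1 h := rfl

@[simp] theorem length_seen (i : Fin 4) (w : World M) (h : List (Profile D.k)) :
    (D.seen i w h).length = h.length := by
  induction h generalizing w with
  | nil => rfl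
  | cons a h ih => simp [ih]

theorem obs_inl {w : World M} {a b : Profile D.k} {i : Fin 4} {w' : World M}
    (h : D.obs w a i = .inl (w', b)) : w' = (D.react w a).1 ∧ b = a := by
  unfold obs at h
  split at h
  · simp only [Sum.inl.injEq, Prod.mk.injEq] at h
    exact ⟨h.1.symm, h.2.symm⟩
  · simp at h

theorem obs_inr {w : World M} {a : Profile D.k} {i : Fin 4} {o : Signal L} {b : Fin (D.k + 3)}
    (h : D.obs w a i = .inr (o, b)) : (D.react w a).2 i = some o ∧ b = a i := by
  unfold obs at h
  split at h <;> simp_all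

/-! ### What the players know -/

/-- A player who sees everything in every round knows the history. -/
theorem eq_of_seen_isLeft {i : Fin 4} {w w' : World M} {h h' : List (Profile D.k)}
    (hw : ∀ o ∈ D.seen i w h, o.isLeft) (he : D.seen i w h = D.seen i w' h') : h = h' := by
  induction h generalizing w w' h' with
  | nil =>
    have := congrArg List.length he
    simp only [length_seen, List.length_nil] at this
    exact (List.length_eq_zero_iff.1 this.symm).symm
  | cons a h ih =>
    cases h' with
    | nil => simp at he
    | cons a' h' =>
      simp only [seen_cons, List.cons.injEq, List.mem_cons, forall_eq_or_imp] at he hw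
      obtain ⟨⟨x, b⟩, hx⟩ := Sum.isLeft_iff.1 hw.1
      have e1 := D.obs_inl hx
      have e2 := D.obs_inl (he.1 ▸ hx)
      rw [ih hw.2 he.2, ← e1.2, ← e2.2]

theorem isLeft_seen_revealed (i : Fin 4) (h : List (Profile D.k)) :
    ∀ o ∈ D.seen i .revealed h, o.isLeft := by
  induction h with
  | nil => simp
  | cons a h ih => simpa [obs, react] using ih

theorem isLeft_seen_quiet {i : Fin 4} (hi : i ≠ 3) (h : List (Profile D.k)) :
    ∀ o ∈ D.seen i .quiet h, o.isLeft := by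
  induction h with
  | nil => simp
  | cons a h ih =>
    by_cases ha : a = 0
    · fin_cases i <;> simp_all [obs, react]
    · simpa [obs, react, ha] using D.isLeft_seen_revealed i h

/-- The positions that are reached after player `0` has departed from the action `0` in the first
round, alone or together with player `3`. -/
def Hidden : World M → Prop
  | .init | .quiet | .revealed => False
  | _ => True

theorem hidden_react {w : World M} (hw : Hidden w) (a : Profile D.k) :
    Hidden (D.react w a).1 := by
  cases w <;> simp only [Hidden] at hw <;> simp only [react] <;>
    (try split_ifs) <;> first | trivial | (split <;> trivial)

/-- At hidden positions only the action of player `3` matters. -/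
theorem react_congr {w : World M} (hw : Hidden w) {a b : Profile D.k} (h : a 3 = b 3) :
    D.react w a = D.react w b := by
  cases w <;> simp only [Hidden] at hw <;> simp only [react, h]
  congr 1; rw [h]

/-- At hidden positions nobody but player `0` sees everything. -/
theorem isRight_obs {w : World M} (hw : Hidden w) {i : Fin 4} (hi : i ≠ 0) (a : Profile D.k) :
    (D.obs w a i).isRight := by
  obtain ⟨o, ho⟩ : ∃ o, (D.react w a).2 i = some o := by
    cases w <;> simp only [Hidden] at hw <;> simp only [react] <;>
      (try split_ifs) <;>
      first
        | (fin_cases i <;> simp_all; done)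
        | (split <;> fin_cases i <;> simp_all)
  simp [obs, ho]

theorem isRight_seen {w : World M} (hw : Hidden w) {i : Fin 4} (hi : i ≠ 0)
    (h : List (Profile D.k)) : ∀ o ∈ D.seen i w h, o.isRight := by
  induction h generalizing w with
  | nil => simp
  | cons a h ih =>
    simp only [seen_cons, List.mem_cons, forall_eq_or_imp]
    exact ⟨D.isRight_obs hw hi a, ih (D.hidden_react hw a)⟩

theorem exists_isLeft_seen_quiet (i : Fin 4) {h : List (Profile D.k)} (hh : ∃ a ∈ h, a ≠ 0) :
    ∃ o ∈ D.seen i .quiet h, o.isLeft := by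
  induction h with
  | nil => simp at hh
  | cons a h ih =>
    by_cases ha : a = 0
    · subst ha
      obtain ⟨o, ho, ho'⟩ := ih (by simpa using hh)
      exact ⟨o, by simp [react, ho], ho'⟩
    · exact ⟨_, List.mem_cons_self, by simp [obs, react, ha]⟩

/-- At the position `quiet`, even player `3` knows the history as soon as an action differs
from `0`: a silent round tells her that all actions were `0`. -/
theorem eq_of_seen_quiet {h h' : List (Profile D.k)} (hh : ∃ a ∈ h, a ≠ 0)
    (he : D.seen 3 .quiet h = D.seen 3 .quiet h') : h = h' := by
  induction h generalizing h' with
  | nil => simp at hh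
  | cons a h ih =>
    cases h' with
    | nil => simp at he
    | cons a' h' =>
      simp only [seen_cons, List.cons.injEq] at he
      by_cases ha : a = 0 <;> by_cases ha' : a' = 0
      · subst ha ha'
        rw [ih (by simpa using hh) (by simpa [react] using he.2)]
      · simp [obs, react, ha, ha'] at he
      · simp [obs, react, ha, ha'] at he
      · simp only [obs, react, ha, ha', if_false, Sum.inl.injEq, Prod.mk.injEq, true_and] at he
        rw [he.1, D.eq_of_seen_isLeft (D.isLeft_seen_revealed 3 h) he.2]

/-- A history that does not begin with the departure of player `0` is known to every player,
provided, in the case of player `3`, that some action differs from `0`. -/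
theorem eq_of_seen_init {i : Fin 4} {a : Profile D.k} {h h' : List (Profile D.k)}
    (h1 : a ≠ alone) (h2 : a ≠ joint) (h3 : i = 3 → ∃ b ∈ a :: h, b ≠ 0)
    (he : D.seen i .init (a :: h) = D.seen i .init h') : a :: h = h' := by
  by_cases hi : i = 3
  · subst hi
    have h3 := h3 rfl
    cases h' with
    | nil => simp at he
    | cons a' h' =>
      by_cases ha : a = 0
      · subst ha
        have h3' : ∃ b ∈ h, b ≠ 0 := by simpa using h3
        by_cases ha' : a' = 0
        · subst ha'
          simp only [seen_cons, List.cons.injEq] at he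
          rw [D.eq_of_seen_quiet h3' (by simpa [react] using he.2)]
        · exfalso
          simp only [seen_cons, List.cons.injEq] at he
          by_cases ha1 : a' = alone
          · subst ha1
            obtain ⟨o, ho, ho'⟩ := D.exists_isLeft_seen_quiet 3 h3'
            have e : D.seen 3 .quiet h = D.seen 3 .fork h' := by
              simpa [react, ha'] using he.2
            have := D.isRight_seen (w := .fork) trivial (i := 3) (by decide) h' o (e ▸ ho)
            cases o <;> simp_all
          · by_cases ha2 : a' = joint
            · subst ha2
              simp [obs, react, ha', ha1] at he
            · simp [obs, react, ha', ha1, ha2] at he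
      · refine D.eq_of_seen_isLeft ?_ he
        simpa [obs, react, ha, h1, h2] using D.isLeft_seen_revealed 3 h
  · refine D.eq_of_seen_isLeft ?_ he
    by_cases ha : a = 0
    · subst ha
      have := D.isLeft_seen_quiet hi h
      simp only [seen_cons, List.mem_cons, forall_eq_or_imp]
      refine ⟨?_, by simpa [react] using this⟩
      fin_cases i <;> simp_all [obs, react]
    · simpa [obs, react, ha, h1, h2] using D.isLeft_seen_revealed i h

/-! ### The words that the observers see -/

/-- The letter contained in an observation. -/
def letterOf : Obs M L D.k → Option L
  | .inr (.letter l, _) => some l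
  | _ => none

/-- The word contained in a sequence of observations, if each of them contains a letter. -/
def wordOf : List (Obs M L D.k) → Option (List L)
  | [] => some []
  | o :: s => (D.letterOf o).bind fun l => (wordOf s).map (l :: ·)

/-- The word that player `3` writes. -/
def written (h : List (Profile D.k)) : List L := h.map fun a => D.dec (a 3)

theorem wordOf_copy {i : Fin 4} (hi : i = 1 ∨ i = 2) (h : List (Profile D.k)) :
    D.wordOf (D.seen i .copy h) = some (D.written h) := by
  induction h with
  | nil => rfl
  | cons a h ih =>
    have e : D.letterOf (D.obs .copy a i) = some (D.dec (a 3)) := by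
      rcases hi with rfl | rfl <;> rfl
    have e2 : (D.react .copy a).1 = .copy := rfl
    simp [wordOf, e, e2, ih, written]

theorem wordOf_convert (m : M) (h : List (Profile D.k)) :
    D.wordOf (D.seen 1 (.convert m) h) =
      (D.T.runFrom m (D.written h)).map fun _ => D.written h := by
  induction h generalizing m with
  | nil => rfl
  | cons a h ih =>
    cases hs : D.T.step m (D.dec (a 3)) with
    | none => simp [wordOf, letterOf, obs, react, hs, written, Transducer.runFrom]
    | some p =>
      have e : (D.react (.convert m) a).1 = .convert p.1 := by simp [react, hs]
      have e2 : D.letterOf (D.obs (.convert m) a 1) = some (D.dec (a 3)) := by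
        simp [letterOf, obs, react, hs]
      rw [seen_cons, wordOf, e, e2, ih p.1]
      simp only [written, List.map_cons, Transducer.runFrom_cons (l' := p.2) hs]
      simp [Function.comp_def]

theorem wordOf_convert_image (m : M) (h : List (Profile D.k)) :
    D.wordOf (D.seen 2 (.convert m) h) = D.T.runFrom m (D.written h) := by
  induction h generalizing m with
  | nil => rfl
  | cons a h ih =>
    cases hs : D.T.step m (D.dec (a 3)) with
    | none => simp [wordOf, letterOf, obs, react, hs, written, Transducer.runFrom]
    | some p =>
      have e : (D.react (.convert m) a).1 = .convert p.1 := by simp [react, hs]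
      have e2 : D.letterOf (D.obs (.convert m) a 2) = some p.2 := by
        simp [letterOf, obs, react, hs]
      rw [seen_cons, wordOf, e, e2, ih p.1]
      simp only [written, List.map_cons, Transducer.runFrom_cons (l' := p.2) hs]
      simp

theorem blank_notMem_wordOf_decoy {i : Fin 4} (hi : i = 1 ∨ i = 2) {h : List (Profile D.k)}
    {v : List L} (hv : D.wordOf (D.seen i .decoy h) = some v) : D.blank ∉ v := by
  induction h generalizing v with
  | nil => simp [wordOf] at hv; simp [hv]
  | cons a h ih =>
    by_cases hb : D.dec (a 3) = D.blank
    · rcases hi with rfl | rfl <;> simp [wordOf, letterOf, obs, react, hb] at hv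
    · have e : D.letterOf (D.obs .decoy a i) = some (D.dec (a 3)) := by
        rcases hi with rfl | rfl <;> simp [letterOf, obs, react, hb]
      have e2 : (D.react .decoy a).1 = .decoy := by simp [react, hb]
      simp only [seen_cons, wordOf, e, e2, Option.bind_some, Option.map_eq_some_iff] at hv
      obtain ⟨v', hv', rfl⟩ := hv
      simp [ih hv', Ne.symm hb]

theorem wordOf_decoy {i : Fin 4} (hi : i = 1 ∨ i = 2) {h : List (Profile D.k)}
    (hb : D.blank ∉ D.written h) : D.wordOf (D.seen i .decoy h) = some (D.written h) := by
  induction h with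
  | nil => rfl
  | cons a h ih =>
    simp only [written, List.map_cons, List.mem_cons, not_or] at hb
    have hb' : D.dec (a 3) ≠ D.blank := Ne.symm hb.1
    have e : D.letterOf (D.obs .decoy a i) = some (D.dec (a 3)) := by
      rcases hi with rfl | rfl <;> simp [letterOf, obs, react, hb']
    have e2 : (D.react .decoy a).1 = .decoy := by simp [react, hb']
    simp [wordOf, e, e2, ih hb.2, written]

theorem wordOf_ended {i : Fin 4} (hi : i = 1 ∨ i = 2) (h : List (Profile D.k)) :
    D.wordOf (D.seen i .ended h) = some (List.replicate h.length D.blank) := by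
  induction h with
  | nil => rfl
  | cons a h ih =>
    have e : D.letterOf (D.obs .ended a i) = some D.blank := by rcases hi with rfl | rfl <;> rfl
    have e2 : (D.react .ended a).1 = .ended := rfl
    simp [wordOf, e, e2, ih, List.replicate_succ]

/-- If player `3` plays a letter other than `0` in round `n` and `0` before, then the observers
see the input word for `n`. -/
theorem wordOf_input {i : Fin 4} (hi : i = 1 ∨ i = 2) {n : ℕ} {h : List (Profile D.k)}
    (h0 : ∀ j (hj : j < h.length), j ≤ n → (h[j] 3 = 0 ↔ j < n)) :
    D.wordOf (D.seen i .input h) = some (inputWord D.tick D.mark D.blank n h.length) := by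
  induction h generalizing n with
  | nil => rfl
  | cons a h ih =>
    cases n with
    | zero =>
      have ha : a 3 ≠ 0 := fun h => lt_irrefl 0 ((h0 0 (by simp) le_rfl).1 h)
      have e : D.letterOf (D.obs .input a i) = some D.mark := by
        rcases hi with rfl | rfl <;> simp [letterOf, obs, react, ha]
      have e2 : (D.react .input a).1 = .ended := by simp [react, ha]
      simp only [seen_cons, wordOf, e, e2, D.wordOf_ended hi, Option.bind_some, Option.map_some,
        inputWord, List.length_cons, List.range_succ_eq_map, List.map_cons, List.map_map]
      simp [Function.comp_def]
    | succ n =>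
      have ha : a 3 = 0 := (h0 0 (by simp) (by omega)).2 (by omega)
      have e : D.letterOf (D.obs .input a i) = some D.tick := by
        rcases hi with rfl | rfl <;> simp [letterOf, obs, react, ha]
      have e2 : (D.react .input a).1 = .input := by simp [react, ha]
      have := ih (n := n) fun j hj hjn => by
        have h1 : h[j] 3 = 0 ↔ j + 1 < n + 1 := h0 (j + 1) (by simpa using hj) (by omega)
        rw [h1]
        omega
      simp only [seen_cons, wordOf, e, e2, this, Option.bind_some, Option.map_some,
        inputWord, List.length_cons, List.range_succ_eq_map, List.map_cons, List.map_map]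
      simp [Function.comp_def]

/-- The two observers see the same word at the position `input`. -/
theorem seen_input_congr (h : List (Profile D.k)) :
    D.wordOf (D.seen 1 .input h) = D.wordOf (D.seen 2 .input h) := by
  induction h with
  | nil => rfl
  | cons a h ih =>
    by_cases ha : a 3 = 0
    · simp [wordOf, letterOf, obs, react, ha, ih]
    · simp [wordOf, letterOf, obs, react, ha, D.wordOf_ended]

/-- As soon as the observers have seen a blank, player `3` has been told. -/
theorem told_mem_seen {h : List (Profile D.k)} {v : List L} (ht : D.tick ≠ D.blank)
    (hv : D.wordOf (D.seen 1 .input h) = some v) (hb : D.blank ∈ v) :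
    ∃ b, .inr (.told, b) ∈ D.seen 3 .input h := by
  induction h generalizing v with
  | nil => simp [wordOf] at hv; simp [hv] at hb
  | cons a h ih =>
    by_cases ha : a 3 = 0
    · have e : D.letterOf (D.obs .input a 1) = some D.tick := by simp [letterOf, obs, react, ha]
      have e2 : (D.react .input a).1 = .input := by simp [react, ha]
      simp only [seen_cons, wordOf, e, e2, Option.bind_some, Option.map_eq_some_iff] at hv ⊢
      obtain ⟨v', hv', rfl⟩ := hv
      obtain ⟨b, hb⟩ := ih hv' (by simpa [ht.symm] using hb)
      exact ⟨b, List.mem_cons_of_mem _ hb⟩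
    · exact ⟨a 3, by simp [obs, react, ha]⟩

theorem told_notMem_seen_quiet (b : Fin (D.k + 3)) (h : List (Profile D.k)) :
    .inr (.told, b) ∉ D.seen 3 .quiet h := by
  induction h with
  | nil => simp
  | cons a h ih =>
    by_cases ha : a = 0
    · simpa [obs, react, ha] using ih
    · simp only [seen_cons, List.mem_cons, not_or]
      refine ⟨by simp [obs, react, ha], fun hm => ?_⟩
      have := D.isLeft_seen_revealed 3 h _ (by simpa [react, ha] using hm)
      simp at this

/-- At hidden positions player `3` remembers her actions, and these determine what the observers
are told. -/
theorem wordOf_congr {w : World M} (hw : Hidden w) {h h' : List (Profile D.k)}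
    (he : D.seen 3 w h = D.seen 3 w h') (i : Fin 4) (hi : i = 1 ∨ i = 2) :
    D.wordOf (D.seen i w h) = D.wordOf (D.seen i w h') := by
  induction h generalizing w h' with
  | nil =>
    have := congrArg List.length he
    simp only [length_seen, List.length_nil] at this
    rw [List.length_eq_zero_iff.1 this.symm]
  | cons a h ih =>
    cases h' with
    | nil => simp at he
    | cons a' h' =>
      simp only [seen_cons, List.cons.injEq] at he
      obtain ⟨⟨o, b⟩, hx⟩ := Sum.isRight_iff.1 (D.isRight_obs hw (i := 3) (by decide) a)
      have e : a 3 = a' 3 := (D.obs_inr hx).2.symm.trans (D.obs_inr (he.1 ▸ hx)).2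
      have er := D.react_congr hw e
      have h2 := he.2
      rw [← er] at h2
      have e3 : D.letterOf (D.obs w a i) = D.letterOf (D.obs w a' i) := by
        obtain ⟨⟨o, b⟩, hx⟩ := Sum.isRight_iff.1 (D.isRight_obs hw (i := i)
          (by rcases hi with rfl | rfl <;> decide) a)
        have hr := (D.obs_inr hx).1
        have hr' := hr
        rw [er] at hr'
        cases o <;> simp [obs, hr, hr', letterOf]
      rw [seen_cons, seen_cons, wordOf, wordOf, e3, ← er, ih (D.hidden_react hw a) h2]

/-- Observations of letters consist of the letters and of the own actions. -/
theorem seen_eq_of_wordOf {i : Fin 4} {w w' : World M} {h h' : List (Profile D.k)} {v : List L}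
    (h1 : D.wordOf (D.seen i w h) = some v) (h2 : D.wordOf (D.seen i w' h') = some v)
    (h3 : h.map (· i) = h'.map (· i)) : D.seen i w h = D.seen i w' h' := by
  induction h generalizing w w' h' v with
  | nil => simp_all
  | cons a h ih =>
    cases h' with
    | nil => simp at h3
    | cons a' h' =>
      simp only [seen_cons, wordOf, Option.bind_eq_some_iff, Option.map_eq_some_iff] at h1 h2
      obtain ⟨l, hl, v1, hv1, rfl⟩ := h1
      obtain ⟨l', hl', v2, hv2, hv⟩ := h2
      simp only [List.cons.injEq] at hv
      obtain ⟨rfl, rfl⟩ := hv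
      simp only [List.map_cons, List.cons.injEq] at h3
      have key : ∀ {x : World M} {b : Profile D.k}, D.letterOf (D.obs x b i) = some l' →
          D.obs x b i = .inr (.letter l', b i) := by
        intro x b hb
        cases ho : D.obs x b i with
        | inl y => simp [ho, letterOf] at hb
        | inr y =>
          obtain ⟨o, c⟩ := y
          have := (D.obs_inr ho).2
          cases o <;> simp [ho, letterOf] at hb
          simp [hb, this]
      rw [seen_cons, seen_cons, ih hv1 hv2 h3.2, key hl, key hl', h3.1]

end Spec

/-! ### Finiteness of the game and the intended play -/

theorem finite_world {M : Type} [Finite M] : Finite (World M) := by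
  let f : World M → Fin 10 ⊕ M
    | .init => .inl 0
    | .quiet => .inl 1
    | .revealed => .inl 2
    | .fork => .inl 3
    | .input => .inl 4
    | .ended => .inl 5
    | .copy => .inl 6
    | .convert m => .inr m
    | .decoyFork => .inl 7
    | .decoy => .inl 8
    | .failed => .inl 9
  refine Finite.of_injective f ?_
  intro a b h
  cases a <;> cases b <;> simp_all [f]

theorem finite_signal {L : Type} [Finite L] : Finite (Signal L) := by
  let f : Signal L → Fin 3 ⊕ L
    | .silent => .inl 0
    | .told => .inl 1
    | .letter l => .inr l
    | .fail => .inl 2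
  refine Finite.of_injective f ?_
  intro a b h
  cases a <;> cases b <;> simp_all [f]

theorem two_ne_zero_one {k : ℕ} : (2 : Fin (k + 3)) ≠ 0 ∧ (2 : Fin (k + 3)) ≠ 1 := by
  have h : 2 % (k + 3) = 2 := Nat.mod_eq_of_lt (by omega)
  constructor <;> simp [Fin.ext_iff, h]

theorem alone_ne_zero {k : ℕ} : (alone : Profile k) ≠ 0 := fun h => by
  have := congrFun h 0
  simp [alone] at this

theorem joint_ne_zero {k : ℕ} : (joint : Profile k) ≠ 0 := fun h => by
  have := congrFun h 0
  simp [joint] at this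

theorem joint_ne_alone {k : ℕ} : (joint : Profile k) ≠ alone := fun h => by
  have := congrFun h 3
  simp [joint, alone] at this

/-- The intended play: only player `3` ever departs from the action `0`, in round `n + 3`. -/
def play (k n : ℕ) : ℕ → Profile k := fun t => if t = n + 2 then ![0, 0, 0, 1] else 0

theorem play_min (k n t : ℕ) : play k n (min t (n + 3)) = play k n t := by
  unfold play
  congr 1
  simp only [eq_iff_iff]
  omega

theorem play_zero (k n : ℕ) : play k n 0 = 0 := by simp [play]

theorem play_three (k n t : ℕ) : play k n t 3 = if t = n + 2 then 1 else 0 := by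
  unfold play
  split_ifs <;> rfl

theorem play_ne_zero {k n t : ℕ} {a : Profile k} (h : a ≠ play k n t)
    (h3 : a 3 = play k n t 3) : a ≠ 0 := by
  rintro rfl
  by_cases ht : t = n + 2
  · simp [play_three, ht] at h3
  · simp [play, ht] at h

theorem length_history {I : Type} {A : I → Type} (π : Play A) (t : ℕ) :
    (π.history t).length = t := by
  simp [Play.history]

theorem history_succ {I : Type} {A : I → Type} (π : Play A) (t : ℕ) :
    π.history (t + 1) = π 0 :: (List.range t).map fun j => π (j + 1) := by
  simp [Play.history, List.range_succ_eq_map, Function.comp_def]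

theorem history_concat {I : Type} {A : I → Type} (π : Play A) (t : ℕ) :
    π.history (t + 1) = π.history t ++ [π t] := by
  simp [Play.history, List.range_succ]

theorem history_congr {I : Type} {A : I → Type} {π π' : Play A} {t : ℕ}
    (h : ∀ j < t, π j = π' j) : π.history t = π'.history t := by
  refine List.map_congr_left fun j hj => h j (by simpa using hj)

namespace Spec

variable {M L : Type} (D : Spec M L)

/-! ### Plays in which player `0` departs first -/

/-- Two words lie in the same component of the graph of the transduction. -/
def Linked (x v : List L) : Prop :=
  ∃ d, Reaches D.T.run v d ∧ Reaches D.T.run x d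

variable {D} in
theorem Linked.image {x v u : List L} (h : D.Linked x v) (hu : D.T.run v = some u) :
    D.Linked x u := by
  obtain ⟨d, h1, h2⟩ := h
  rcases reaches_total h1 (.single hu) with h3 | h3
  · exact ⟨u, .refl, h2.trans h3⟩
  · exact ⟨d, h3, h2⟩

variable {D} in
theorem Linked.preimage {x v u : List L} (h : D.Linked x u) (hu : D.T.run v = some u) :
    D.Linked x v := by
  obtain ⟨d, h1, h2⟩ := h
  exact ⟨d, .head hu h1, h2⟩

variable {D} in
theorem Linked.blank_mem (hT : D.T.Preserves D.blank) {x v : List L}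
    (hx : ∀ w, Reaches D.T.run x w → D.blank ∈ w) (h : D.Linked x v) : D.blank ∈ v := by
  obtain ⟨d, h1, h2⟩ := h
  by_contra hb
  exact hT.reaches h1 hb (hx d h2)

/-- Player `0` has departed first, and both observers have seen words linked to `x`. -/
def SeenLinked (x : List L) (h : List (Profile D.k)) : Prop :=
  ∃ a h', h = alone :: a :: h' ∧ ∀ i : Fin 4, i = 1 ∨ i = 2 →
    ∃ v, D.Linked x v ∧ D.wordOf (D.seen i (D.react .fork a).1 h') = some v

/-- If one observer sees a word linked to `x`, then so does the other one. -/
theorem exists_linked_of_linked {x v : List L} {a : Profile D.k} {h : List (Profile D.k)}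
    {i : Fin 4} (hi : i = 1 ∨ i = 2) (hv : D.Linked x v)
    (hw : D.wordOf (D.seen i (D.react .fork a).1 h) = some v) (j : Fin 4) (hj : j = 1 ∨ j = 2) :
    ∃ u, D.Linked x u ∧ D.wordOf (D.seen j (D.react .fork a).1 h) = some u := by
  by_cases ha : a 3 = 0
  · have e : (D.react .fork a).1 = .input := by simp [react, ha]
    rw [e] at hw ⊢
    refine ⟨v, hv, ?_⟩
    have := D.seen_input_congr h
    rcases hi with rfl | rfl <;> rcases hj with rfl | rfl <;> simp_all
  · by_cases ha1 : a 3 = 1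
    · have e : (D.react .fork a).1 = .convert D.T.start := by simp [react, ha1]
      rw [e] at hw ⊢
      have key : ∃ u, D.T.runFrom D.T.start (D.written h) = some u ∧ D.Linked x (D.written h) := by
        rcases hi with rfl | rfl
        · rw [wordOf_convert, Option.map_eq_some_iff] at hw
          obtain ⟨u, hu, rfl⟩ := hw
          exact ⟨u, hu, hv⟩
        · rw [wordOf_convert_image] at hw
          exact ⟨v, hw, hv.preimage hw⟩
      obtain ⟨u, hu, hl⟩ := key
      rcases hj with rfl | rfl
      · exact ⟨_, hl, by rw [wordOf_convert, hu]; rfl⟩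
      · exact ⟨u, hl.image hu, by rw [wordOf_convert_image, hu]⟩
    · have e : (D.react .fork a).1 = .copy := by simp [react, ha, ha1]
      rw [e, D.wordOf_copy hi] at hw
      rw [e, D.wordOf_copy hj]
      exact ⟨v, hv, hw⟩

/-- The histories at which both observers have seen words linked to `x` are closed under the
indistinguishability of the players other than `0`, provided that every word reached from `x`
contains a blank: the blank rules out the position `decoy`, and for player `3` it rules out that
nobody has departed. -/
theorem SeenLinked.step {D : Spec M L} (hT : D.T.Preserves D.blank) (ht : D.tick ≠ D.blank)
    {x : List L} (hx : ∀ w, Reaches D.T.run x w → D.blank ∈ w) {h h' : List (Profile D.k)}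
    (hh : D.SeenLinked x h) {i : Fin 4} (hi : i ≠ 0) (he : D.seen i .init h = D.seen i .init h') :
    D.SeenLinked x h' := by
  obtain ⟨a, r, rfl, hr⟩ := hh
  obtain ⟨b, c, r', rfl⟩ : ∃ b c r', h' = b :: c :: r' := by
    have := congrArg List.length he
    match h' with
    | [] | [_] => simp at this
    | b :: c :: r' => exact ⟨b, c, r', rfl⟩
  simp only [seen_cons, List.cons.injEq] at he
  obtain ⟨he1, he2, he3⟩ := he
  have e0 : (D.react .init alone).1 = .fork := by simp [react, alone_ne_zero]
  rw [e0] at he2 he3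
  by_cases hi3 : i = 3
  · subst hi3
    by_cases hb : b = alone
    · subst hb
      rw [e0] at he2 he3
      have hac : a 3 = c 3 := by
        obtain ⟨⟨o, y⟩, hy⟩ := Sum.isRight_iff.1
          (D.isRight_obs (w := .fork) trivial (i := 3) (by decide) a)
        exact (D.obs_inr hy).2.symm.trans (D.obs_inr (he2 ▸ hy)).2
      have hf : Hidden (.fork : World M) := trivial
      rw [← D.react_congr hf hac] at he3
      refine ⟨c, r', rfl, fun j hj => ?_⟩
      obtain ⟨v, hv, hw⟩ := hr j hj
      refine ⟨v, hv, ?_⟩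
      rw [← D.react_congr hf hac, ← hw]
      exact (D.wordOf_congr (D.hidden_react hf a) he3 j hj).symm
    · exfalso
      by_cases hb0 : b = 0
      · subst hb0
        have e1 : (D.react .init 0).1 = .quiet := by simp [react]
        rw [e1] at he2 he3
        have hmem : D.seen 3 .fork (a :: r) = D.seen 3 .quiet (c :: r') := by simp [he2, he3]
        have htold : ∃ y, .inr (.told, y) ∈ D.seen 3 .fork (a :: r) := by
          by_cases ha : a 3 = 0
          · have e : (D.react .fork a).1 = .input := by simp [react, ha]
            obtain ⟨v, hv, hw⟩ := hr 1 (.inl rfl)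
            rw [e] at hw
            obtain ⟨y, hy⟩ := D.told_mem_seen ht hw (hv.blank_mem hT hx)
            exact ⟨y, by rw [seen_cons, e]; exact List.mem_cons_of_mem _ hy⟩
          · refine ⟨a 3, ?_⟩
            by_cases ha1 : a 3 = 1 <;> simp [obs, react, ha, ha1]
        obtain ⟨y, hy⟩ := htold
        exact D.told_notMem_seen_quiet y _ (hmem ▸ hy)
      · by_cases hb1 : b = joint
        · subst hb1
          simp [obs, react, joint_ne_zero, joint_ne_alone, alone_ne_zero] at he1
        · simp [obs, react, alone_ne_zero, hb, hb0, hb1] at he1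
  · have hi' : i = 1 ∨ i = 2 := by fin_cases i <;> simp_all
    obtain ⟨v, hv, hw⟩ := hr i hi'
    by_cases hb : b = alone
    · subst hb
      rw [e0] at he3
      rw [he3] at hw
      exact ⟨c, r', rfl, D.exists_linked_of_linked hi' hv hw⟩
    · exfalso
      by_cases hb1 : b = joint
      · subst hb1
        have e1 : (D.react .init joint).1 = .decoyFork := by
          simp [react, joint_ne_zero, joint_ne_alone]
        have e2 : (D.react .decoyFork c).1 = .decoy := rfl
        rw [e1, e2] at he3
        rw [he3] at hw
        exact D.blank_notMem_wordOf_decoy hi' hw (hv.blank_mem hT hx)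
      · by_cases hb0 : b = 0
        · subst hb0
          rcases hi' with rfl | rfl <;> simp [obs, react, alone_ne_zero] at he1
        · rcases hi' with rfl | rfl <;> simp [obs, react, alone_ne_zero, hb, hb0, hb1] at he1

/-! ### Chains of histories that simulate the transducer -/

/-- The history in which player `3` writes `w`, while the other players act as in `h`. -/
def rewrite (h : List (Profile D.k)) (w : List L) : List (Profile D.k) :=
  List.zipWith (fun a l => Function.update a 3 (D.enc l)) h w

theorem written_rewrite {h : List (Profile D.k)} {w : List L} (hw : w.length = h.length) :
    D.written (D.rewrite h w) = w := by
  induction h generalizing w with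
  | nil => simp_all [rewrite, written]
  | cons a h ih =>
    cases w with
    | nil => simp at hw
    | cons l w =>
      have := ih (w := w) (by simpa using hw)
      simp_all [rewrite, written, D.dec_enc]

theorem map_rewrite {h : List (Profile D.k)} {w : List L} (hw : w.length = h.length) {i : Fin 4}
    (hi : i ≠ 3) : (D.rewrite h w).map (· i) = h.map (· i) := by
  induction h generalizing w with
  | nil => simp [rewrite]
  | cons a h ih =>
    cases w with
    | nil => simp at hw
    | cons l w =>
      have := ih (w := w) (by simpa using hw)
      simp_all [rewrite]

/-- The history in which player `0` departs first, player `3` chooses `c` in the second round and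
writes `w` afterwards, while the other players act as in `a :: h`. -/
def branch (a : Profile D.k) (h : List (Profile D.k)) (c : Fin (D.k + 3)) (w : List L) :
    List (Profile D.k) :=
  alone :: Function.update a 3 c :: D.rewrite h w

theorem seen_alone_eq {i : Fin 4} (hi : i = 1 ∨ i = 2) {a b : Profile D.k}
    {h h' : List (Profile D.k)} (hab : a i = b i)
    (he : D.seen i (D.react .fork a).1 h = D.seen i (D.react .fork b).1 h') :
    D.seen i .init (alone :: a :: h) = D.seen i .init (alone :: b :: h') := by
  have e0 : (D.react .init alone).1 = .fork := by simp [react, alone_ne_zero]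
  have e1 : ∀ a : Profile D.k, D.obs .fork a i = .inr (.silent, a i) := by
    intro a
    by_cases h0 : a 3 = 0 <;> by_cases h1 : a 3 = 1 <;> rcases hi with rfl | rfl <;>
      simp [obs, react, h0, h1]
  simp only [seen_cons, e0, e1, hab, he]

theorem react_fork_update (a : Profile D.k) :
    (D.react .fork (Function.update a 3 1)).1 = .convert D.T.start ∧
      (D.react .fork (Function.update a 3 2)).1 = .copy := by
  simp [react, two_ne_zero_one]

theorem seen_branch_copy_convert {a : Profile D.k} {h : List (Profile D.k)} {w u : List L}
    (hw : w.length = h.length) (hu : D.T.run w = some u) :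
    D.seen 1 .init (D.branch a h 2 w) = D.seen 1 .init (D.branch a h 1 w) := by
  refine D.seen_alone_eq (.inl rfl) (by simp) ?_
  rw [(D.react_fork_update a).1, (D.react_fork_update a).2]
  refine D.seen_eq_of_wordOf (v := w) ?_ ?_ rfl
  · rw [D.wordOf_copy (.inl rfl), D.written_rewrite hw]
  · rw [D.wordOf_convert, D.written_rewrite hw, show D.T.runFrom D.T.start w = some u from hu]
    rfl

theorem seen_branch_convert_copy {a : Profile D.k} {h : List (Profile D.k)} {w u : List L}
    (hw : w.length = h.length) (hu : D.T.run w = some u) :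
    D.seen 2 .init (D.branch a h 1 w) = D.seen 2 .init (D.branch a h 2 u) := by
  have hlen : u.length = h.length := (Transducer.length_runFrom hu).trans hw
  refine D.seen_alone_eq (.inr rfl) (by simp) ?_
  rw [(D.react_fork_update a).1, (D.react_fork_update a).2]
  refine D.seen_eq_of_wordOf (v := u) ?_ ?_ ?_
  · rw [D.wordOf_convert_image, D.written_rewrite hw]
    exact hu
  · rw [D.wordOf_copy (.inr rfl), D.written_rewrite hlen]
  · rw [D.map_rewrite hw (by decide), D.map_rewrite hlen (by decide)]

theorem seen_branch_decoy {a : Profile D.k} {h : List (Profile D.k)} {w : List L}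
    (hw : w.length = h.length) (hb : D.blank ∉ w) :
    D.seen 1 .init (D.branch a h 2 w) = D.seen 1 .init (joint :: a :: D.rewrite h w) := by
  have e0 : (D.react .init alone).1 = .fork := by simp [react, alone_ne_zero]
  have e1 : (D.react .init joint).1 = .decoyFork := by simp [react, joint_ne_zero, joint_ne_alone]
  have e2 : (D.react .decoyFork a).1 = .decoy := rfl
  have h1 : D.obs .init alone 1 = D.obs .init joint 1 := by
    simp only [obs, react, alone_ne_zero, joint_ne_zero, joint_ne_alone, if_true, if_false]
    rfl
  have hf := (D.react_fork_update a).2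
  have h2 : D.obs .fork (Function.update a 3 2) 1 = D.obs .decoyFork a 1 := by
    simp [obs, react, two_ne_zero_one]
  simp only [branch, seen_cons, e0, e1, e2, h1, h2, hf, List.cons.injEq, true_and]
  refine D.seen_eq_of_wordOf (v := w) ?_ ?_ rfl
  · rw [D.wordOf_copy (.inl rfl), D.written_rewrite hw]
  · rw [D.wordOf_decoy (.inl rfl), D.written_rewrite hw]
    rwa [D.written_rewrite hw]

end Spec

/-! ### The instances -/

theorem length_view {I : Type} {A B V : I → Type} (G : Game A B V) (i : I) (h : History A) :
    (G.view i h).length = h.length := by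
  unfold Game.view
  rw [List.length_map]
  generalize G.init = v
  induction h generalizing v with
  | nil => rfl
  | cons a h ih => simp [Game.observationsFrom, ih]

theorem getElem_history {I : Type} {A : I → Type} (π : Play A) {j t : ℕ}
    (h : j < (π.history t).length) : (π.history t)[j] = π j := by
  simp [Play.history]

theorem out_apply {I : Type} {A B V : I → Type} (G : Game A B V) (s : StrategyProfile A B)
    (t : ℕ) (i : I) : G.out s t i = s i (G.view i ((G.out s).history t)) :=
  (G.follows_iff_eq_out s _).2 rfl t i

namespace Spec

variable {M L : Type} (D : Spec M L)

/-- The strategies that play the intended play whatever is observed. -/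
def constStrategy (n : ℕ) : StrategyProfile (fun _ : Fin 4 => Fin (D.k + 3))
    (fun _ => Fin (Nat.card (Obs M L D.k))) :=
  fun i l => play D.k n l.length i

theorem isFiniteState_constStrategy (n : ℕ) (i : Fin 4) :
    IsFiniteState (D.constStrategy n i) := by
  refine ⟨n + 4, 0, fun q _ => ⟨min (q + 1) (n + 3), by omega⟩, fun q => play D.k n q i,
    fun l => ?_⟩
  have key : ∀ (l : List (Fin (Nat.card (Obs M L D.k)))) (q : Fin (n + 4)),
      (l.foldl (fun (q : Fin (n + 4)) _ => (⟨min (q + 1) (n + 3), by omega⟩ : Fin (n + 4))) q).val =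
        min (q + l.length) (n + 3) := by
    intro l
    induction l with
    | nil => intro q; simp; omega
    | cons b l ih => intro q; rw [List.foldl_cons, ih]; simp; omega
  have := key l 0
  simp only [Fin.val_zero, zero_add] at this
  change play D.k n l.length i = play D.k n (Fin.val (List.foldl _ _ l)) i
  rw [this, play_min]

variable [Finite M] [Finite L]

/-- A numbering of the positions. -/
noncomputable def worldEquiv (M : Type) [Finite M] : World M ≃ Fin (Nat.card (World M)) :=
  have := finite_world (M := M)
  Finite.equivFin _

/-- A numbering of the observations. -/
noncomputable def obsEquiv : Obs M L D.k ≃ Fin (Nat.card (Obs M L D.k)) :=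
  have := finite_world (M := M)
  have := finite_signal (L := L)
  Finite.equivFin _

/-- The game: the position is the local state of player `0`. -/
noncomputable def game : Game (I := Fin 4) (fun _ => Fin (D.k + 3))
    (fun _ => Fin (Nat.card (Obs M L D.k))) (fun _ => Fin (Nat.card (World M))) where
  init _ := worldEquiv M .init
  trans v a :=
    let w := (worldEquiv M).symm (v 0)
    (fun i => worldEquiv M (if i = 0 then (D.react w a).1 else .init),
      fun i => D.obsEquiv (D.obs w a i))
  own i := by
    refine ⟨fun b => match D.obsEquiv.symm b with
      | .inl (w, a) => (a i, worldEquiv M (if i = 0 then w else .init))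
      | .inr (_, b) => (b, worldEquiv M .init), fun v a => ?_⟩
    dsimp only
    rw [Equiv.symm_apply_apply]
    cases h : D.obs ((worldEquiv M).symm (v 0)) a i with
    | inl x =>
      have := D.obs_inl (w' := x.1) (b := x.2) h
      simp [← this.1, this.2]
    | inr x =>
      have := D.obs_inr (o := x.1) (b := x.2) h
      by_cases hi : i = 0
      · subst hi
        have h0 : ∀ w : World M, (D.react w a).2 0 = none := by
          intro w
          cases w <;> simp only [react] <;> (try split_ifs) <;> first | rfl | (split <;> rfl)
        simp [h0] at this
      · simp [this.2, hi]

theorem view_game (i : Fin 4) (h : List (Profile D.k)) :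
    D.game.view i h = (D.seen i .init h).map D.obsEquiv := by
  have key : ∀ (w : World M) (v : Fin 4 → Fin (Nat.card (World M))), v 0 = worldEquiv M w →
      (D.game.observationsFrom v h).map (fun b => b i) = (D.seen i w h).map D.obsEquiv := by
    induction h with
    | nil => intros; rfl
    | cons a h ih =>
      intro w v hv
      have hw : (worldEquiv M).symm (v 0) = w := by simp [hv]
      rw [Game.observationsFrom, List.map_cons, seen_cons, List.map_cons, ih (D.react w a).1]
      · simp [game, hw]
      · simp [game, hw]
  exact key .init _ rfl

theorem indist_game {i : Fin 4} {h h' : List (Profile D.k)} :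
    D.game.Indist i h h' ↔ D.seen i .init h = D.seen i .init h' := by
  unfold Game.Indist
  rw [view_game, view_game, (List.map_injective_iff.2 D.obsEquiv.injective).eq_iff]

/-- The automaton that accepts exactly the intended play. -/
def automaton (S : Type) (k n : ℕ) : BuchiAutomaton (Fin (n + 4)) (S × Profile k) where
  start := 0
  step q x := if x.2 = play k n q then {⟨min (q + 1) (n + 3), by omega⟩} else ∅
  accept := {⟨n + 3, by omega⟩}

/-- The instance of the synthesis problem for the number `n`. -/
noncomputable def problem (n : ℕ) : Problem where
  n := 4
  nA _ := D.k + 3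
  nB _ := Nat.card (Obs M L D.k)
  nV _ := Nat.card (World M)
  game := D.game
  nQ := n + 4
  aut := automaton _ D.k n

theorem accepts_automaton {S : Type} {k n : ℕ} {x : ℕ → S × Profile k} :
    (automaton S k n).Accepts x ↔ ∀ t, (x t).2 = play k n t := by
  constructor
  · rintro ⟨ρ, h0, hstep, -⟩
    have key : ∀ t, (x t).2 = play k n (ρ t) ∧ (ρ (t + 1) : ℕ) = min ((ρ t : ℕ) + 1) (n + 3) := by
      intro t
      have := hstep t
      unfold automaton at this
      dsimp only at this
      split_ifs at this with hc
      · exact ⟨hc, congrArg Fin.val (Finset.mem_singleton.1 this)⟩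
      · simp at this
    have hρ : ∀ t, (ρ t : ℕ) = min t (n + 3) := by
      intro t
      induction t with
      | zero => rw [h0]; rfl
      | succ t ih => rw [(key t).2, ih]; omega
    intro t
    rw [(key t).1, hρ, play_min]
  · intro hx
    refine ⟨fun t => ⟨min t (n + 3), by omega⟩, rfl, fun t => ?_, fun t => ?_⟩
    · unfold automaton
      dsimp only
      rw [if_pos ((hx t).trans (play_min ..).symm), Finset.mem_singleton]
      simp only [Fin.mk.injEq]
      omega
    · refine ⟨max t (n + 3), le_max_left _ _, Finset.mem_singleton.2 ?_⟩
      simp only [Fin.mk.injEq]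
      omega

theorem solvable_problem_iff {n : ℕ} : (D.problem n).Solvable ↔
    ∃ s : StrategyProfile (fun _ : Fin 4 => Fin (D.k + 3))
        (fun _ => Fin (Nat.card (Obs M L D.k))),
      (∀ i, IsFiniteState (s i)) ∧ D.game.IsDeviatorDetection {play D.k n} s := by
  have h : (D.problem n).target = ({play D.k n} : Set (ℕ → Profile D.k)) := by
    ext π
    exact accepts_automaton.trans funext_iff.symm
  unfold Problem.Solvable
  rw [h]
  exact Iff.rfl

theorem out_constStrategy (n : ℕ) : D.game.out (D.constStrategy n) = play D.k n := by
  symm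
  rw [← Game.follows_iff_eq_out]
  intro t i
  rw [constStrategy, length_view, length_history]

/-! ### Solvable instances -/

/-- If a prefix of the input word keeps its blanks, then playing the intended play whatever is
observed detects every deviation. -/
theorem solvable_of_blank_mem (hT : D.T.Preserves D.blank) (ht : D.tick ≠ D.blank) {n t : ℕ}
    (hx : ∀ w, Reaches D.T.run (inputWord D.tick D.mark D.blank n t) w → D.blank ∈ w) :
    (D.problem n).Solvable := by
  refine D.solvable_problem_iff.2 ⟨D.constStrategy n, D.isFiniteState_constStrategy n,
    D.out_constStrategy n, fun i r hne => ?_⟩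
  rw [out_constStrategy] at hne ⊢
  have hoth : ∀ t j, j ≠ i →
      D.game.out (Function.update (D.constStrategy n) i r) t j = play D.k n t j := by
    intro t j hj
    rw [out_apply, Function.update_of_ne hj, constStrategy, length_view, length_history]
  generalize D.game.out (Function.update (D.constStrategy n) i r) = π at hne hoth
  -- The only deviation that is not immediately public is that of player `0` in the first round.
  by_cases hc : i = 0 ∧ π 0 0 = 1
  · obtain ⟨rfl, h0⟩ := hc
    have hπ0 : π 0 = alone := by
      funext j
      by_cases hj : j = 0
      · subst hj; exact h0
      · rw [hoth 0 j hj, play_zero]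
        fin_cases j <;> first | rfl | exact absurd rfl hj
    have hπ3 : ∀ j, π j 3 = if j = n + 2 then 1 else 0 := fun j => by
      rw [hoth j 3 (by decide), play_three]
    refine ⟨t + 2, fun h' hh' => ?_⟩
    have hinit : D.SeenLinked (inputWord D.tick D.mark D.blank n t)
        (Play.history (A := fun _ : Fin 4 => Fin (D.k + 3)) π (t + 2)) := by
      refine ⟨π 1, (List.range t).map fun j => π (j + 2), ?_, fun i hi => ?_⟩
      · rw [history_succ, hπ0, List.range_succ_eq_map]
        simp [Function.comp_def]
      · refine ⟨_, ⟨_, .refl, .refl⟩, ?_⟩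
        have e : (D.react .fork (π 1)).1 = .input := by simp [react, hπ3]
        rw [e, D.wordOf_input hi (n := n)]
        · simp
        · intro j hj hjn
          simp only [List.getElem_map, List.getElem_range, hπ3]
          split_ifs with h <;> simp <;> omega
    have hlink : D.SeenLinked (inputWord D.tick D.mark D.blank n t) h' := by
      induction hh' with
      | refl => exact hinit
      | tail _ hs ih =>
        obtain ⟨j, hj, hs⟩ := hs
        exact ih.step hT ht hx hj (D.indist_game.1 hs)
    obtain ⟨a, r, rfl, -⟩ := hlink
    refine ⟨0, by simp, rfl, ?_, fun j hj => ?_⟩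
    · simpa [play_zero] using alone_ne_zero
    · rw [play_zero]
      fin_cases j <;> first | rfl | exact absurd rfl hj
  · obtain ⟨T, hT1, hT2⟩ : ∃ T, π T ≠ play D.k n T ∧ ∀ j < T, π j = play D.k n j := by
      have hex : ∃ T, π T ≠ play D.k n T := Function.ne_iff.1 hne
      classical
      exact ⟨Nat.find hex, Nat.find_spec hex, fun j hj => not_not.1 (Nat.find_min hex hj)⟩
    refine ⟨T + 1, fun h' hh' => ?_⟩
    have h0 : π 0 ≠ alone ∧ π 0 ≠ joint := by
      constructor <;> intro h
      · refine hc ⟨?_, by rw [h]; rfl⟩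
        by_contra hi
        have := hoth 0 0 (Ne.symm hi)
        rw [h, play_zero] at this
        simp [alone] at this
      · have h3 : i = 3 := by
          by_contra hi
          have := hoth 0 3 (Ne.symm hi)
          rw [h, play_zero] at this
          simp [joint] at this
        have := hoth 0 0 (by rw [h3]; decide)
        rw [h, play_zero] at this
        simp [joint] at this
    have hsingle : h' = Play.history (A := fun _ : Fin 4 => Fin (D.k + 3)) π (T + 1) := by
      induction hh' with
      | refl => rfl
      | tail _ hs ih =>
        obtain ⟨j, hj, hs⟩ := hs
        rw [D.indist_game, ih, history_succ] at hs
        rw [← D.eq_of_seen_init h0.1 h0.2 ?_ hs, ← history_succ]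
        rintro rfl
        rw [← history_succ]
        refine ⟨π T, by simp [history_concat], play_ne_zero hT1 (hoth T 3 hj)⟩
    subst hsingle
    refine ⟨T, by simp [length_history], ?_, ?_, fun j hj => ?_⟩
    · rw [history_concat, List.take_left' (length_history _ _)]
      exact history_congr hT2
    · rwa [getElem_history]
    · exact (congrFun (getElem_history π (t := T + 1) (by simp [length_history])) j).trans
        (hoth T j hj)

end Spec

namespace Spec

variable {M L : Type} (D : Spec M L)

/-! ### Unsolvable instances -/

theorem seen_input_silent {h : List (Profile D.k)} (hh : ∀ a ∈ h, a 3 = 0) :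
    D.seen 3 .input h = List.replicate h.length (.inr (.silent, 0)) := by
  induction h with
  | nil => rfl
  | cons a h ih =>
    have ha : a 3 = 0 := hh a List.mem_cons_self
    have e : (D.react .input a).1 = .input := by simp [react, ha]
    have e2 : D.obs .input a 3 = .inr (.silent, 0) := by simp [obs, react, ha]
    rw [seen_cons, e, e2, ih fun b hb => hh b (List.mem_cons_of_mem _ hb), List.length_cons,
      List.replicate_succ]

theorem seen_alone_silent {h : List (Profile D.k)} (hh : ∀ a ∈ h, a 3 = 0) :
    D.seen 3 .init (alone :: h) = List.replicate (h.length + 1) (.inr (.silent, 0)) := by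
  have e0 : (D.react .init alone).1 = .fork := by simp [react, alone_ne_zero]
  have e1 : D.obs .init alone 3 = .inr (.silent, 0) := by
    simp only [obs, react, alone_ne_zero, if_true, if_false]
    rfl
  rw [seen_cons, e0, e1, List.replicate_succ]
  cases h with
  | nil => rfl
  | cons a h =>
    have ha : a 3 = 0 := hh a List.mem_cons_self
    have e : (D.react .fork a).1 = .input := by simp [react, ha]
    have e2 : D.obs .fork a 3 = .inr (.silent, 0) := by simp [obs, react, ha]
    rw [seen_cons, e, e2, D.seen_input_silent fun b hb => hh b (List.mem_cons_of_mem _ hb),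
      List.length_cons, List.replicate_succ]

theorem seen_replicate_silent (t : ℕ) :
    D.seen 3 .init (List.replicate t 0) = List.replicate t (.inr (.silent, 0)) := by
  have key : ∀ t, D.seen 3 .quiet (List.replicate t 0) = List.replicate t (.inr (.silent, 0)) := by
    intro t
    induction t with
    | zero => rfl
    | succ t ih => simp [List.replicate_succ, obs, react, ih]
  cases t with
  | zero => rfl
  | succ t => simp [List.replicate_succ, obs, react, key]

/-- The histories with different first profiles for the players `0` and `3` are not recognised as
deviations of player `0`. -/
theorem joint_notMem_deviation (n : ℕ) (h : List (Profile D.k)) :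
    joint :: h ∉ deviation (A := fun _ : Fin 4 => Fin (D.k + 3)) (play D.k n) 0 := by
  rintro ⟨t, ht, h1, -, h3⟩
  cases t with
  | zero =>
    have := h3 3 (by decide)
    rw [play_zero] at this
    simp [joint] at this
  | succ t =>
    rw [List.take_succ_cons, history_succ, List.cons.injEq, play_zero] at h1
    exact joint_ne_zero h1.1

variable [Finite M] [Finite L]

/-- In a solution the deviation of player `0` in the first round becomes common knowledge, and then
no word without blanks can be reached from the input word. -/
theorem blank_mem_of_solvable {n : ℕ} (h : (D.problem n).Solvable) :
    ∃ t, ∀ w, Reaches D.T.run (inputWord D.tick D.mark D.blank n t) w → D.blank ∈ w := by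
  obtain ⟨s, -, hout, hdev⟩ := D.solvable_problem_iff.1 h
  rw [Set.mem_singleton_iff] at hout
  rw [hout] at hdev
  let r : List (Fin (Nat.card (Obs M L D.k))) → Fin (D.k + 3) := fun l => if l = [] then 1 else 0
  specialize hdev 0 r
  have hs : ∀ t i, play D.k n t i = s i (D.game.view i
      (Play.history (A := fun _ : Fin 4 => Fin (D.k + 3)) (play D.k n) t)) := by
    intro t i
    have := out_apply D.game s t i
    rwa [hout] at this
  have h0 : D.game.out (Function.update s 0 r) 0 0 = 1 := by
    rw [out_apply, Function.update_self]
    rfl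
  have hoth : ∀ t i, i ≠ 0 → D.game.out (Function.update s 0 r) t i = s i (D.game.view i
      (Play.history (D.game.out (Function.update s 0 r)) t)) := by
    intro t i hi
    rw [out_apply, Function.update_of_ne hi]
  generalize D.game.out (Function.update s 0 r) = π at hdev h0 hoth
  have hπ0 : π 0 = alone := by
    funext i
    by_cases hi : i = 0
    · subst hi; exact h0
    · have h1 := hoth 0 i hi
      have h2 := hs 0 i
      rw [play_zero] at h2
      rw [h1]
      refine Eq.trans h2.symm ?_
      fin_cases i <;> first | rfl | exact absurd rfl hi
  have hne : π ≠ play D.k n := by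
    intro h
    rw [h, play_zero] at hπ0
    exact alone_ne_zero hπ0.symm
  obtain ⟨t, ht⟩ := hdev hne
  -- Player `3` cannot distinguish the two plays before she has played `1`.
  have h3 : ∀ k ≤ n + 2, π k 3 = if k = n + 2 then 1 else 0 := by
    intro k
    induction k using Nat.strong_induction_on with
    | _ k ih =>
      intro hk
      have hview : D.game.view 3 (Play.history (A := fun _ : Fin 4 => Fin (D.k + 3)) π k) =
          D.game.view 3 (Play.history (A := fun _ : Fin 4 => Fin (D.k + 3)) (play D.k n) k) := by
        rw [view_game, view_game]
        congr 1
        have e1 : Play.history (A := fun _ : Fin 4 => Fin (D.k + 3)) (play D.k n) k =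
            List.replicate k 0 := by
          rw [List.eq_replicate_iff]
          refine ⟨length_history _ _, fun a ha => ?_⟩
          obtain ⟨j, hj, rfl⟩ := List.mem_map.1 ha
          have : j ≠ n + 2 := by have := List.mem_range.1 hj; omega
          simp [play, this]
        rw [e1, seen_replicate_silent]
        cases k with
        | zero => rfl
        | succ k =>
          rw [history_succ, hπ0, D.seen_alone_silent]
          · simp
          · intro a ha
            obtain ⟨j, hj, rfl⟩ := List.mem_map.1 ha
            have hj := List.mem_range.1 hj
            rw [ih (j + 1) (by omega) (by omega), if_neg (by omega)]
      rw [hoth k 3 (by decide), hview, ← hs, play_three]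
  match t with
  | 0 =>
    obtain ⟨j, hj, -⟩ := ht _ .refl
    simp [Play.history] at hj
  | 1 =>
    refine absurd (ht [joint] (.single ⟨1, by decide, ?_⟩)) (D.joint_notMem_deviation n [])
    rw [indist_game, history_succ, hπ0]
    simp only [List.range_zero, List.map_nil, seen_cons, seen_nil, obs, react, alone_ne_zero,
      joint_ne_zero, joint_ne_alone, if_true, if_false]
    rfl
  -- From round `3` on, the observers are shown the letters of the input word.
  | t + 2 =>
    set rest : List (Profile D.k) := (List.range t).map fun j => π (j + 2) with hrest
    have hhist : Play.history (A := fun _ : Fin 4 => Fin (D.k + 3)) π (t + 2) =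
        alone :: π 1 :: rest := by
      rw [history_succ, hπ0, List.range_succ_eq_map]
      simp [hrest, Function.comp_def]
    rw [hhist] at ht
    have hlen : rest.length = t := by simp [hrest]
    -- Every word reached from the input word is the content of a history in the chain.
    have hchain : ∀ w, Reaches D.T.run (inputWord D.tick D.mark D.blank n t) w →
        w.length = rest.length ∧ Relation.ReflTransGen
        (fun h₁ h₂ => ∃ i ∈ ({j | j ≠ 0} : Set (Fin 4)), D.game.Indist i h₁ h₂)
        (alone :: π 1 :: rest) (D.branch (π 1) rest 2 w) := by
      intro w hw
      induction hw with
      | refl =>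
        have hl : (inputWord D.tick D.mark D.blank n t).length = rest.length := by
          simp [inputWord, hlen]
        refine ⟨hl, .single ⟨1, by decide, D.indist_game.2 ?_⟩⟩
        refine D.seen_alone_eq (.inl rfl) (by simp) ?_
        have e : (D.react .fork (π 1)).1 = .input := by
          have := h3 1 (by omega)
          rw [if_neg (by omega)] at this
          simp [react, this]
        rw [e, (D.react_fork_update (π 1)).2]
        refine D.seen_eq_of_wordOf (v := inputWord D.tick D.mark D.blank n t) ?_ ?_ ?_
        · rw [D.wordOf_input (.inl rfl) (n := n), hlen]
          intro j hj hjn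
          have e : rest[j] = π (j + 2) := by simp [hrest]
          rw [e, h3 (j + 2) (by omega)]
          split_ifs with h <;> simp <;> omega
        · rw [D.wordOf_copy (.inl rfl), D.written_rewrite hl]
        · rw [D.map_rewrite hl (by decide)]
      | @tail v u _ hu ih =>
        refine ⟨(Transducer.length_runFrom hu).trans ih.1, ?_⟩
        exact (ih.2.tail ⟨1, by decide, D.indist_game.2 (D.seen_branch_copy_convert ih.1 hu)⟩).tail
          ⟨2, by decide, D.indist_game.2 (D.seen_branch_convert_copy ih.1 hu)⟩
    refine ⟨t, fun w hw => ?_⟩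
    by_contra hb
    obtain ⟨hwl, hwc⟩ := hchain w hw
    have hlast := hwc.tail ⟨1, by decide,
      D.indist_game.2 (D.seen_branch_decoy (a := π 1) hwl hb)⟩
    exact D.joint_notMem_deviation n _ (ht _ hlast)

theorem solvable_problem_iff_blank_mem (hT : D.T.Preserves D.blank) (ht : D.tick ≠ D.blank)
    (n : ℕ) : (D.problem n).Solvable ↔
      ∃ t, ∀ w, Reaches D.T.run (inputWord D.tick D.mark D.blank n t) w → D.blank ∈ w :=
  ⟨D.blank_mem_of_solvable, fun ⟨_, h⟩ => D.solvable_of_blank_mem hT ht h⟩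

end Spec

/-! ### The description of the instances is computable -/

theorem finsetCode_singleton {k : ℕ} (q : Fin k) :
    finsetCode {q} = [(q : ℕ)] := by
  have h : (List.finRange k).filter (fun x => x ∈ ({q} : Finset (Fin k))) = [q] := by
    refine List.perm_singleton.1 ((List.perm_ext_iff_of_nodup
      ((List.nodup_finRange k).filter _) (List.nodup_singleton q)).2 fun x => ?_)
    simp
  unfold finsetCode
  rw [h]
  rfl

theorem profileCode_play (k n t : ℕ) :
    profileCode (play k n t) = [0, 0, 0, if t = n + 2 then 1 else 0] := by
  unfold play
  split_ifs <;> simp [profileCode, List.ofFn_succ]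

theorem finsetCode_step {S : Type} {k n : ℕ} (q : Fin (n + 4))
    (x : S × Profile k) : finsetCode ((Spec.automaton S k n).step q x) =
      if profileCode x.2 = [0, 0, 0, if (q : ℕ) = n + 2 then 1 else 0] then
        [min ((q : ℕ) + 1) (n + 3)] else [] := by
  simp only [Spec.automaton, ← profileCode_play k, profileCode_injective.eq_iff]
  split_ifs
  · exact finsetCode_singleton _
  · simp [finsetCode]

namespace Spec

variable {M L : Type} (D : Spec M L) [Finite M] [Finite L]

theorem computable_code_problem : Computable fun n => (D.problem n).code := by
  let lt : List ((Fin 4 → Fin (Nat.card (World M))) × Profile D.k) :=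
    profiles (fun _ : Fin 4 => Nat.card (World M)) ×ˢ profiles (fun _ : Fin 4 => D.k + 3)
  let letters : List (List ℕ × List ℕ) := lt.map fun x => (profileCode x.1, profileCode x.2)
  let succs : ℕ → ℕ → List ℕ → List ℕ := fun n q a =>
    if a = [0, 0, 0, if q = n + 2 then 1 else 0] then [min (q + 1) (n + 3)] else []
  let table : ℕ → List ((ℕ × List ℕ × List ℕ) × List ℕ) := fun n =>
    (List.range (n + 4)).flatMap fun q => letters.map fun x => ((q, x.1, x.2), succs n q x.2)
  have hcode : ∀ n, (D.problem n).code = ((D.problem 0).code.1, (n + 4, 0, table n, [n + 3])) := by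
    intro n
    have hstep : ∀ (q : Fin (n + 4)) (x : (Fin 4 → Fin (Nat.card (World M))) × Profile D.k),
        finsetCode ((D.problem n).aut.step q x) = succs n q (profileCode x.2) :=
      fun q x => finsetCode_step q x
    have htable : (List.finRange (n + 4) ×ˢ lt).map (fun x =>
        (((x.1 : ℕ), profileCode x.2.1, profileCode x.2.2),
          finsetCode ((D.problem n).aut.step x.1 x.2))) = table n := by
      simp only [hstep, table, letters]
      rw [← List.map_coe_finRange_eq_range, List.flatMap_map]
      change ((List.finRange (n + 4)).flatMap fun q => lt.map (Prod.mk q)).map _ = _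
      rw [List.map_flatMap]
      simp [Function.comp_def]
    have hacc : finsetCode (D.problem n).aut.accept = [n + 3] := finsetCode_singleton _
    rw [← htable, ← hacc]
    rfl
  have hprim : Primrec table := by
    have hsuccs : Primrec fun y : (ℕ × ℕ) × List ℕ => succs y.1.1 y.1.2 y.2 := by
      have h1 : Primrec fun y : (ℕ × ℕ) × List ℕ => y.1.1 := Primrec.fst.comp Primrec.fst
      have h2 : Primrec fun y : (ℕ × ℕ) × List ℕ => y.1.2 := Primrec.snd.comp Primrec.fst
      have h3 : Primrec fun y : (ℕ × ℕ) × List ℕ => if y.1.2 = y.1.1 + 2 then 1 else 0 :=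
        Primrec.ite (Primrec.eq.comp h2 (Primrec.nat_add.comp h1 (Primrec.const 2)))
          (Primrec.const 1) (Primrec.const 0)
      have h0 : Primrec fun _ : (ℕ × ℕ) × List ℕ => 0 := Primrec.const 0
      refine Primrec.ite (Primrec.eq.comp Primrec.snd ?_) ?_ (Primrec.const [])
      · exact Primrec.list_cons.comp h0 (Primrec.list_cons.comp h0 (Primrec.list_cons.comp h0
          (Primrec.list_cons.comp h3 (Primrec.const []))))
      · exact Primrec.list_cons.comp (Primrec.nat_min.comp
          (Primrec.nat_add.comp h2 (Primrec.const 1)) (Primrec.nat_add.comp h1 (Primrec.const 3)))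
          (Primrec.const [])
    refine Primrec.list_flatMap
      (Primrec.list_range.comp (Primrec.nat_add.comp Primrec.id (Primrec.const 4))) ?_
    refine Primrec.list_map (Primrec.const letters) (Primrec.pair (Primrec.pair
      (Primrec.snd.comp Primrec.fst) Primrec.snd) ?_)
    exact hsuccs.comp (Primrec.pair Primrec.fst (Primrec.snd.comp Primrec.snd))
  refine Computable.of_eq ?_ fun n => (hcode n).symm
  refine Primrec.to_comp (Primrec.pair (Primrec.const _) (Primrec.pair ?_ (Primrec.pair
    (Primrec.const _) (Primrec.pair hprim ?_))))
  · exact Primrec.nat_add.comp Primrec.id (Primrec.const 4)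
  · exact Primrec.list_cons.comp (Primrec.nat_add.comp Primrec.id (Primrec.const 3))
      (Primrec.const [])

end Spec

end DeviatorDetection

/-- The synthesis problem for deviator detection strategies is undecidable: no algorithm decides,
given the explicit description of a finite game and of an automaton for the target set, whether
there is a finite-state strategy profile for deviator detection. -/
theorem theorem2 :
    ¬ ∃ f : DeviatorDetection.ProblemCode → Bool, Computable f ∧
      ∀ P : DeviatorDetection.Problem, f P.code = true ↔ P.Solvable := by
  rintro ⟨f, hf, hsolv⟩
  obtain ⟨M, L, hM, hL, T, tick, mark, blank, hT, ht, hnot⟩ :=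
    DeviatorDetection.exists_transducer_not_computable
  let e := Finite.equivFin L
  let dec : Fin (Nat.card L + 3) → L := fun a =>
    if h : (a : ℕ) < Nat.card L then e.symm ⟨a, h⟩ else blank
  let D : DeviatorDetection.Spec M L :=
    { T, tick, mark, blank, k := Nat.card L, dec, enc := fun l => (e l).castAdd 3,
      dec_enc := fun l => by simp [dec] }
  let hdec : DecidablePred fun n => ∃ t, ∀ w,
      StateTransition.Reaches T.run (DeviatorDetection.inputWord tick mark blank n t) w →
        blank ∈ w := fun n => decidable_of_iff (f (D.problem n).code = true)
    ((hsolv _).trans (D.solvable_problem_iff_blank_mem hT ht n))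
  refine hnot ⟨hdec, ?_⟩
  refine (hf.comp D.computable_code_problem).of_eq fun n => ?_
  rw [Bool.eq_iff_iff, decide_eq_true_iff]
  exact (hsolv _).trans (D.solvable_problem_iff_blank_mem hT ht n)
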